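/- **Setting.** Let $A=(a_{pq})_{p,q\in P}$ be a generalized Cartan matrix of affine type, indexed by a finite set $P$, with all entries in $\{2,0,-1,-2\}$, and let $\Gamma$ be its Dynkin diagram: distinct vertices $p,q\in P$ are adjacent when $a_{pq}\neq0$. (Affine type means that $\Gamma$ is connected, $A$ has corank $1$, there is a real vector $u$ with all coordinates positive and $Au=0$, and $Av\ge 0$ implies $Av=0$ for real $v$.) Write $p\,\mathcal C\,q$ if $p=q$ or $p,q$ are adjacent. A *labelled heap* over $\Gamma$ is a locally finite poset $E$ with a map $\varepsilon:E\to P$ such that $\alpha,\beta$ are comparable whenever $\varepsilon(\alpha)\,\mathcal C\,\varepsilon(\beta)$, and such that $\le$ is the transitive closure of the relation "$\alpha\le\beta$ and $\varepsilon(\alpha)\,\mathcal C\,\varepsilon(\beta)$". It is *fibred* if each $\varepsilon^{-1}(p)$ is nonempty and unbounded above and below, and if for all adjacent $p,p'$ every $\alpha\in\varepsilon^{-1}(p)$ covers or is covered by some $\beta\in\varepsilon^{-1}(p')$. A fibred heap is *full* if $\sum_{\gamma\in(\alpha,\beta)}a_{p,\varepsilon(\gamma)}=-2$ for all $\alpha<\beta$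 with $\varepsilon(\alpha)=\varepsilon(\beta)=p$ and $(\alpha,\beta)\cap\varepsilon^{-1}(p)=\emptyset$. A *simply folded full heap* over $\Gamma$ is either a full heap $(E,\le,\varepsilon)$ over $\Gamma$, or a heap $(E,\le,f\circ\varepsilon_0)$, where * $(E,\le,\varepsilon_0)$ is a full heap over the diagram $\Gamma_0$ of a simply laced (no entry $-2$) generalized Cartan matrix of affine type; * $\mu$ is an automorphism of $\Gamma_0$ of order exactly $2$ such that $\mu(p)$ is never adjacent to $p$; * $f$ sends each vertex $p$ of $\Gamma_0$ to its $\mu$-orbit $\bar p$; * $\Gamma_0$ folds to $\Gamma$ via $\mu$, i.e. the vertices of $\Gamma$ are the $\mu$-orbits, and for distinct orbits $\bar p\ne\bar q$ the entry $a_{\bar p\bar q}$ is $0$ if no vertex of $\bar p$ is adjacent to a vertex of $\bar q$, is $-2$ if $p\ne\mu(p)$ and some vertex of $\bar q$ is adjacent to both $p$ and $\mu(p)$, and is $-1$ otherwise; * $\alpha,\beta\in E$ are comparable whenever $\mu(\varepsilon_0(\alpha))\,\mathcal C\,\varepsilon_0(\beta)$. Let $E=(E,\le,\varepsilon)$ be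 a simply folded full heap over $\Gamma$. A *proper ideal* of $E$ is an order ideal (down-set) $F$ such that $\emptyset\subsetneq F\subsetneq E$ and $\emptyset\subsetneq F\cap\varepsilon^{-1}(p)\subsetneq\varepsilon^{-1}(p)$ for every vertex $p$; let $\mathcal B$ be the set of proper ideals. For a vertex $i$ and $I\in\mathcal B$ put $S_i(I)=I\setminus\{\gamma\}$ if there is $\gamma\in I$ with label $i$ such that $I\setminus\{\gamma\}$ is an ideal; otherwise $S_i(I)=I\cup\{\gamma\}$ if there is $\gamma\notin I$ with label $i$ such that $I\cup\{\gamma\}$ is an ideal; otherwise $S_i(I)=I$ (in each case there is at most one such $\gamma$). Let $W$ be the Weyl group of $A$: it has generators $s_i$ $(i\in P)$ and relations $s_i^2=1$ and, for $i\ne j$, $(s_is_j)^{m}=1$ with $m=2,3,4$ when $a_{ij}a_{ji}=0,1,2$ respectively (no relation when $a_{ij}a_{ji}=4$). It acts linearly on the root lattice $\mathbb Z\Pi=\bigoplus_{i\in P}\mathbb Z\alpha_i$ by $s_i(v)=v-\langle v,\alpha_i^\vee\rangle\alpha_i$, where $\langle\alpha_j,\alpha_i^\vee\rangle=a_{ij}$.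 The *real roots* are the vectors $w(\alpha_i)$ with $w\in W$, $i\in P$. The *character* of a pair $(F,F')\in\mathcal B\times\mathcal B$ is $$\chi(F,F')=\sum_{p\in P}\bigl(|(F'\setminus F)\cap\varepsilon^{-1}(p)|-|(F\setminus F')\cap\varepsilon^{-1}(p)|\bigr)\alpha_p\in\mathbb Z\Pi ,$$ and $F,F'$ are *skew* if $\chi(F,F')$ is a real root. **Theorem 4.1.** Let $E$ be a simply folded full heap over $\Gamma$ as above. Then $F\setminus F'$ is finite for all $F,F'\in\mathcal B$ (so that $\chi$ is well defined), there is an action of $W$ on $\mathcal B$ with $s_i\cdot I=S_i(I)$ for all $i\in P$ and $I\in\mathcal B$, and this action has the following properties. (i) $\chi(w(F),w(F'))=w(\chi(F,F'))$ for all $F,F'\in\mathcal B$ and $w\in W$. (ii) For all $F,F'\in\mathcal B$ and $w\in W$, the ideals $F,F'$ are skew if and only if $w(F),w(F')$ are skew. (iii) The action of $W$ on $\mathcal B$ is faithful. -/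

import Mathlib

/-! ## Generalized Cartan matrices and their Dynkin diagrams -/

namespace FullHeap

section Cartan

variable {P : Type*}

/-- Generalized Cartan matrices that are *doubly laced*, i.e. with entries in `{2, 0, -1, -2}`
(all generalized Cartan matrices considered here are of this kind). -/
structure IsGCM (A : Matrix P P ℤ) : Prop where
  diag : ∀ i, A i i = 2
  nonpos : ∀ i j, i ≠ j → A i j ≤ 0
  zero_symm : ∀ i j, A i j = 0 ↔ A j i = 0
  doublyLaced : ∀ i j, A i j = 2 ∨ A i j = 0 ∨ A i j = -1 ∨ A i j = -2

/-- Simply laced: no entry equal to `-2`. -/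
def IsSimplyLaced (A : Matrix P P ℤ) : Prop := ∀ i j, A i j ≠ -2

/-- The simple graph underlying the Dynkin diagram: `i` and `j` are adjacent when they are
distinct and the entries `A i j`, `A j i` are not zero. -/
def dynkinGraph (A : Matrix P P ℤ) : SimpleGraph P :=
  SimpleGraph.fromRel fun i j => A i j ≠ 0

/-- The relation `𝒞` on vertices: equal or adjacent in the Dynkin diagram. -/
def Concurs (A : Matrix P P ℤ) (p q : P) : Prop := p = q ∨ (dynkinGraph A).Adj p q

/-- Generalized Cartan matrices of affine type: indecomposable, of corank `1`, with `A u = 0` for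
some `u > 0`, and such that `A v ≥ 0` implies `A v = 0` (vectors are real, and `u > 0` is meant in
each coordinate). -/
structure IsAffine [Fintype P] (A : Matrix P P ℤ) : Prop where
  gcm : IsGCM A
  indecomposable : (dynkinGraph A).Connected
  corank : (A.map (Int.cast : ℤ → ℝ)).rank + 1 = Fintype.card P
  exists_pos : ∃ u : P → ℝ, (∀ i, 0 < u i) ∧ (A.map (Int.cast : ℤ → ℝ)).mulVec u = 0
  nonneg : ∀ v : P → ℝ, (∀ i, 0 ≤ (A.map (Int.cast : ℤ → ℝ)).mulVec v i) →
    (A.map (Int.cast : ℤ → ℝ)).mulVec v = 0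

end Cartan

/-! ## Heaps, fibred heaps, full heaps -/

section Heap

variable {P E : Type*} [PartialOrder E]

/-- `(E, ≤, ε)` is a labelled heap over the Dynkin diagram of `A` (local finiteness of `E` is
recorded by an instance `LocallyFiniteOrder E` where it is needed). -/
structure IsHeap (A : Matrix P P ℤ) (ε : E → P) : Prop where
  comparable : ∀ α β, Concurs A (ε α) (ε β) → α ≤ β ∨ β ≤ α
  le_iff_transGen : ∀ α β, α ≤ β ↔
    Relation.TransGen (fun x y => x ≤ y ∧ Concurs A (ε x) (ε y)) α β

/-- Fibred heaps: each fibre `ε⁻¹(p)` is a nonempty chain without upper or lower end, and each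
element with label `p` covers or is covered by an element with label `p'`, for each `p'` adjacent
to `p`. -/
structure IsFibred (A : Matrix P P ℤ) (ε : E → P) : Prop where
  heap : IsHeap A ε
  fibre_nonempty : ∀ p, ∃ α, ε α = p
  unbounded_above : ∀ α, ∃ β, ε β = ε α ∧ α < β
  unbounded_below : ∀ α, ∃ β, ε β = ε α ∧ β < α
  exists_cover : ∀ (α : E) (p' : P), (dynkinGraph A).Adj (ε α) p' →
    ∃ β, ε β = p' ∧ (β ⋖ α ∨ α ⋖ β)

/-- Full heaps: fibred, and for `α < β` consecutive elements of the fibre of `p`, the sum of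
`a_{p, ε(γ)}` over the open interval `(α, β)` is `-2`. -/
structure IsFull [LocallyFiniteOrder E] (A : Matrix P P ℤ) (ε : E → P) : Prop where
  fibred : IsFibred A ε
  sum_Ioo : ∀ α β : E, α < β → ε α = ε β → (∀ γ ∈ Finset.Ioo α β, ε γ ≠ ε α) →
    ∑ γ ∈ Finset.Ioo α β, A (ε α) (ε γ) = -2

/-- The Dynkin diagram of the simply laced matrix `A₀` folds to that of `A` via the diagram
automorphism `μ` of order two; `f` sends a vertex to its `μ`-orbit. The entry of `A` at two distinct
orbits `p̄`, `q̄` is `0` if the orbits are not joined by an edge; otherwise it is `-2` when `q` is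
adjacent to both of the distinct vertices `p`, `μ p` (a double edge with an arrow
towards `p̄`), and `-1` when it is not. -/
structure Folds {Q : Type*} (A₀ : Matrix Q Q ℤ) (μ : Equiv.Perm Q) (f : Q → P)
    (A : Matrix P P ℤ) : Prop where
  automorphism : ∀ p q, A₀ (μ p) (μ q) = A₀ p q
  order_two : orderOf μ = 2
  not_adj : ∀ p, ¬ (dynkinGraph A₀).Adj p (μ p)
  surjective : Function.Surjective f
  orbits : ∀ p q, f p = f q ↔ q = p ∨ q = μ p
  diag : ∀ p, A (f p) (f p) = 2
  entry_double : ∀ p q, f p ≠ f q → p ≠ μ p →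
    (dynkinGraph A₀).Adj p q → (dynkinGraph A₀).Adj (μ p) q → A (f p) (f q) = -2
  entry_single : ∀ p q, f p ≠ f q → (dynkinGraph A₀).Adj p q →
    ¬ (p ≠ μ p ∧ (dynkinGraph A₀).Adj (μ p) q) → A (f p) (f q) = -1
  entry_zero : ∀ p q, f p ≠ f q → ¬ (dynkinGraph A₀).Adj p q →
    ¬ (dynkinGraph A₀).Adj (μ p) q → A (f p) (f q) = 0

/-- Simply folded full heaps over the Dynkin diagram of `A` (of affine type): either a full heap,
or the relabelling `f ∘ ε₀` of a full heap `ε₀` over a simply laced affine diagram that folds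
to the diagram of `A` via `μ`, subject to the comparability condition. -/
def IsSimplyFoldedFull [LocallyFiniteOrder E] (A : Matrix P P ℤ) (ε : E → P) : Prop :=
  IsFull A ε ∨
  ∃ (Q : Type) (_ : Fintype Q) (A₀ : Matrix Q Q ℤ) (μ : Equiv.Perm Q) (f : Q → P) (ε₀ : E → Q),
    IsAffine A₀ ∧ IsSimplyLaced A₀ ∧ Folds A₀ μ f A ∧ IsFull A₀ ε₀ ∧
    (∀ α β : E, Concurs A₀ (μ (ε₀ α)) (ε₀ β) → α ≤ β ∨ β ≤ α) ∧
    ε = f ∘ ε₀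

/-! ## Proper ideals and the operators `S_i` -/

/-- Proper ideals: ideals `F ≠ ∅, E` meeting each fibre of `ε` in a nonempty proper subset. -/
structure IsProperIdeal (ε : E → P) (F : Set E) : Prop where
  isLowerSet : IsLowerSet F
  nonempty : F.Nonempty
  ne_univ : F ≠ Set.univ
  fibre_mem : ∀ p, ∃ α, ε α = p ∧ α ∈ F
  fibre_notMem : ∀ p, ∃ α, ε α = p ∧ α ∉ F

/-- The set `ℬ` of proper ideals. -/
abbrev ProperIdeal (ε : E → P) : Type _ := {F : Set E // IsProperIdeal ε F}

/-- The elements `γ` with label `i` and `{γ} ≺ I`: those of `I` whose removal leaves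
an ideal. When `I` is a proper ideal of a full heap there is at most one. -/
def removable (ε : E → P) (i : P) (I : Set E) : Set E :=
  {γ | ε γ = i ∧ γ ∈ I ∧ IsLowerSet (I \ {γ})}

/-- The elements `γ` with label `i` and `{γ} ≻ I`: those outside `I` whose addition gives
an ideal. When `I` is a proper ideal of a full heap there is at most one. -/
def addable (ε : E → P) (i : P) (I : Set E) : Set E :=
  {γ | ε γ = i ∧ γ ∉ I ∧ IsLowerSet (I ∪ {γ})}

open Classical in
/-- The operator `S_i` on ideals: remove the removable element with label `i` if there is one,
otherwise add the addable element with label `i` if there is one, otherwise do nothing. -/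
noncomputable def simpleMove (ε : E → P) (i : P) (I : Set E) : Set E :=
  if (removable ε i I).Nonempty then I \ removable ε i I
  else if (addable ε i I).Nonempty then I ∪ addable ε i I
  else I

/-- The character of the ordered pair `(F, F')`: in the coordinate `p`, the number of elements with
label `p` in `F' \ F` minus the number of those in `F \ F'`. -/
noncomputable def character (ε : E → P) (F F' : ProperIdeal ε) : P → ℤ := fun p =>
  (({α | ε α = p} ∩ (F'.1 \ F.1)).ncard : ℤ) - (({α | ε α = p} ∩ (F.1 \ F'.1)).ncard : ℤ)

end Heap

/-! ## The Weyl group, its reflection representation, and the real roots -/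

section Weyl

variable {P : Type*}

/-- The functional `v ↦ ⟨v, α_i^∨⟩` on the root lattice `ℤΠ = (P → ℤ)`; on the simple root
`α_j = Pi.single j 1` its value is `a_{ij}`. -/
def coroot [Fintype P] (A : Matrix P P ℤ) (i : P) : Module.Dual ℤ (P → ℤ) :=
  LinearMap.proj i ∘ₗ A.mulVecLin

theorem coroot_apply [Fintype P] (A : Matrix P P ℤ) (i : P) (v : P → ℤ) :
    coroot A i v = A.mulVec v i := rfl

variable [DecidableEq P]

/-- The Coxeter matrix of `A`: for `i ≠ j` the order of `s_i s_j` is `2, 3, 4, 6` when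
`a_{ij} a_{ji} = 0, 1, 2, 3`, and there is no relation (coded by `0`) otherwise. The value `3` does
not occur for doubly laced matrices. -/
def coxeterMatrix (A : Matrix P P ℤ) : CoxeterMatrix P where
  M := Matrix.of fun i j =>
    if i = j then 1
    else if A i j * A j i = 0 then 2
    else if A i j * A j i = 1 then 3
    else if A i j * A j i = 2 then 4
    else if A i j * A j i = 3 then 6
    else 0
  isSymm := by
    ext i j
    simp only [Matrix.transpose_apply, Matrix.of_apply, eq_comm (a := j) (b := i),
      mul_comm (A j i) (A i j)]
  diagonal i := by simp
  off_diagonal i j h := by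
    simp only [Matrix.of_apply, if_neg h]
    split_ifs <;> decide

/-- The Weyl group `W` of `A`, generated by the `(coxeterMatrix A).simple i`. -/
abbrev WeylGroup (A : Matrix P P ℤ) : Type _ := (coxeterMatrix A).Group

variable [Fintype P]

theorem coroot_single (A : Matrix P P ℤ) (i j : P) : coroot A i (Pi.single j 1) = A i j := by
  simp [coroot_apply]

/-- The reflection `v ↦ v - ⟨v, α_i^∨⟩ α_i` of the root lattice. -/
def simpleReflection (A : Matrix P P ℤ) (hA : IsGCM A) (i : P) : (P → ℤ) ≃ₗ[ℤ] (P → ℤ) :=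
  Module.reflection (x := Pi.single i 1) (f := coroot A i) ((coroot_single A i i).trans (hA.diag i))

theorem simpleReflection_apply (A : Matrix P P ℤ) (hA : IsGCM A) (i : P) (v : P → ℤ) :
    simpleReflection A hA i v = v - coroot A i v • Pi.single i 1 := rfl

theorem simpleReflection_mul_step (A : Matrix P P ℤ) (hA : IsGCM A) (i j : P) (v : P → ℤ)
    (c d : ℤ) :
    (simpleReflection A hA i * simpleReflection A hA j)
        (v + c • Pi.single i 1 + d • Pi.single j 1) =
      v + (-c - coroot A i v - A i j * (-d - coroot A j v - A j i * c)) • Pi.single i 1 +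
        (-d - coroot A j v - A j i * c) • Pi.single j 1 := by
  rw [LinearEquiv.mul_apply]
  simp only [simpleReflection_apply, map_add, map_sub, map_smul, coroot_single, hA.diag]
  module

theorem simpleReflection_isLiftable (A : Matrix P P ℤ) (hA : IsGCM A) :
    (coxeterMatrix A).IsLiftable (simpleReflection A hA) := by
  intro i j
  by_cases hij : i = j
  · subst hij
    rw [CoxeterMatrix.diagonal, pow_one]
    ext1 v
    rw [LinearEquiv.mul_apply]
    exact Module.involutive_reflection _ v
  · have hM : coxeterMatrix A i j =
        if A i j * A j i = 0 then 2 else if A i j * A j i = 1 then 3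
        else if A i j * A j i = 2 then 4 else if A i j * A j i = 3 then 6 else 0 := by
      simp [coxeterMatrix, hij]
    rw [hM]
    refine LinearEquiv.ext fun v => ?_
    have h0 : v = v + (0 : ℤ) • Pi.single i 1 + (0 : ℤ) • Pi.single j 1 := by simp
    have step := simpleReflection_mul_step A hA i j v
    have e1 : ∀ m : ℕ, ∀ u, ((simpleReflection A hA i * simpleReflection A hA j) ^ (m + 1)) u =
        ((simpleReflection A hA i * simpleReflection A hA j) ^ m)
          ((simpleReflection A hA i * simpleReflection A hA j) u) := fun m u => by
      rw [pow_succ, LinearEquiv.mul_apply]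
    have hz := hA.zero_symm i j
    have n1 := hA.nonpos i j hij
    have n2 := hA.nonpos j i (Ne.symm hij)
    rcases hA.doublyLaced i j with a | a | a | a <;>
      rcases hA.doublyLaced j i with b | b | b | b <;>
      first
      | (exfalso; omega)
      | (rw [a, b] at step
         rw [a, b]
         norm_num
         try (conv_lhs => rw [h0]
              simp only [e1, step, pow_zero, LinearEquiv.coe_one, id_eq]
              module))

/-- The reflection representation of the Weyl group on the root lattice, determined by
`s_i ↦ simpleReflection A hA i`. -/
def rootRep (A : Matrix P P ℤ) (hA : IsGCM A) : WeylGroup A →* ((P → ℤ) ≃ₗ[ℤ] (P → ℤ)) :=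
  (coxeterMatrix A).toCoxeterSystem.lift
    ⟨simpleReflection A hA, simpleReflection_isLiftable A hA⟩

theorem rootRep_simple (A : Matrix P P ℤ) (hA : IsGCM A) (i : P) :
    rootRep A hA ((coxeterMatrix A).simple i) = simpleReflection A hA i :=
  (coxeterMatrix A).toCoxeterSystem.lift_apply_simple (simpleReflection_isLiftable A hA) i

/-- The real roots: the vectors `w(α_i)`. -/
def realRoots (A : Matrix P P ℤ) (hA : IsGCM A) : Set (P → ℤ) :=
  {v | ∃ (w : WeylGroup A) (i : P), v = rootRep A hA w (Pi.single i 1)}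

/-- `F` and `F'` are skew, i.e. `(F, F') ∈ Σ(E)`: the character of `(F, F')` is a real root. -/
def IsSkew {E : Type*} [PartialOrder E] (A : Matrix P P ℤ) (hA : IsGCM A) (ε : E → P)
    (F F' : ProperIdeal ε) : Prop :=
  character ε F F' ∈ realRoots A hA

end Weyl

end FullHeap

/-! Attach to a proper ideal `F` the integers `weight ε i F`: `1`, `-1` or `0` according as an
element labelled `i` can be removed, added, or neither. Fullness makes this behave like a weight:
adding `γ` to `F` changes the `i`-th value by `a_{i,ε(γ)}`. Summing over the finite difference of
two ideals, `weight F' - weight F` is the pairing of `χ(F,F')` with the simple coroot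
(`IsWeighted.weight_eq`), while `S_i` moves `F` by `-weight · α_i`.

Fix a base ideal `F₀`. The map `F ↦ χ(F₀,F)` is injective and turns `S_i` into the affine reflection
`v ↦ v - (⟨v,α_i^∨⟩ + b_i) α_i`, with `b_i` the weight of `F₀`. These affine reflections satisfy the
Coxeter relations, hence so do the `S_i`. Taking differences removes the constants `b_i`, which
gives equivariance of `χ`; skewness is then preserved because the real roots are stable under `W`.

Every simple root is a character, so an element acting trivially on ideals acts trivially on the
root lattice. Faithfulness thus reduces to that of the reflection representation, proved by the
positivity argument: `ℓ(ws) > ℓ(w)` implies `w(α_s) ≥ 0`, by reduction to dihedral subgroups.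

Full heaps and folded ones are treated together through `IsWeighted`; in the folded case both
weights and matrix entries are sums over `μ`-orbits. -/

namespace FullHeap

/-! ### Weights of ideals, and changing a proper ideal by one element -/

section Weighted

variable {P E : Type*} [PartialOrder E]

open Classical in
/-- The pairing of the weight attached to an ideal `F` with the simple coroot `α_i^∨`: `1` if an
element with label `i` can be removed from `F`, `-1` if one can be added, and `0` otherwise. -/
noncomputable def weight (ε : E → P) (i : P) (F : Set E) : ℤ :=
  (if (removable ε i F).Nonempty then 1 else 0) - (if (addable ε i F).Nonempty then 1 else 0)

/-- Labelled posets whose proper ideals carry weights compatible with the matrix `A`: adding to an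
ideal an element with label `p` changes the weight by the simple root `α_p`. -/
structure IsWeighted (A : Matrix P P ℤ) (ε : E → P) : Prop where
  chain : ∀ α β, ε α = ε β → α ≤ β ∨ β ≤ α
  unbounded_above : ∀ α, ∃ β, ε β = ε α ∧ α < β
  unbounded_below : ∀ α, ∃ β, ε β = ε α ∧ β < α
  exists_proper : ∀ i, ∃ α, ε α = i ∧ IsProperIdeal ε (Set.Iic α)
  not_both : ∀ i F, IsProperIdeal ε F → (addable ε i F).Nonempty → ¬ (removable ε i F).Nonempty
  weight_insert : ∀ i F γ, IsProperIdeal ε F → γ ∉ F → IsLowerSet (F ∪ {γ}) →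
    weight ε i (F ∪ {γ}) = weight ε i F + A i (ε γ)

theorem isProperIdeal_of_subset {ε : E → P} {F G H : Set E} (hF : IsProperIdeal ε F)
    (hH : IsProperIdeal ε H) (hG : IsLowerSet G) (hFG : F ⊆ G) (hGH : G ⊆ H) :
    IsProperIdeal ε G where
  isLowerSet := hG
  nonempty := hF.nonempty.mono hFG
  ne_univ h := hH.ne_univ (Set.univ_subset_iff.1 (h ▸ hGH))
  fibre_mem p := (hF.fibre_mem p).imp fun _ h => ⟨h.1, hFG h.2⟩
  fibre_notMem p := (hH.fibre_notMem p).imp fun _ h => ⟨h.1, fun h' => h.2 (hGH h')⟩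

/-- Only the fibre of `γ` is at risk of being exhausted; there, a larger element of the fibre lies
outside `F` and replaces `γ`. -/
theorem isProperIdeal_union_singleton {ε : E → P} (hu : ∀ α, ∃ β, ε β = ε α ∧ α < β)
    {F : Set E} (hF : IsProperIdeal ε F) {γ : E}
    (hγ : IsLowerSet (F ∪ {γ})) : IsProperIdeal ε (F ∪ {γ}) := by
  have key : ∀ p, ∃ α, ε α = p ∧ α ∉ F ∪ {γ} := by
    intro p
    obtain ⟨α, rfl, hα⟩ := hF.fibre_notMem p
    obtain ⟨β, hβ, hlt⟩ := hu α
    by_cases h : α = γ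
    · refine ⟨β, hβ, ?_⟩
      rintro (h' | h')
      · exact hα (hF.isLowerSet hlt.le h')
      · exact hlt.ne (h.trans h'.symm)
    · exact ⟨α, rfl, by simp [hα, h]⟩
  refine ⟨hγ, hF.nonempty.mono Set.subset_union_left, ?_, fun p => ?_, key⟩
  · intro h
    obtain ⟨α, -, hα⟩ := key (ε γ)
    exact hα (h ▸ Set.mem_univ α)
  · obtain ⟨α, h, h'⟩ := hF.fibre_mem p
    exact ⟨α, h, Or.inl h'⟩

theorem isProperIdeal_diff_singleton {ε : E → P} (hu : ∀ α, ∃ β, ε β = ε α ∧ β < α)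
    {F : Set E} (hF : IsProperIdeal ε F) {γ : E}
    (hγ : IsLowerSet (F \ {γ})) : IsProperIdeal ε (F \ {γ}) := by
  have key : ∀ p, ∃ α, ε α = p ∧ α ∈ F \ {γ} := by
    intro p
    obtain ⟨α, rfl, hα⟩ := hF.fibre_mem p
    obtain ⟨β, hβ, hlt⟩ := hu α
    by_cases h : α = γ
    · exact ⟨β, hβ, hF.isLowerSet hlt.le hα, fun h' => hlt.ne (Eq.trans h' h.symm)⟩
    · exact ⟨α, rfl, hα, h⟩
  refine ⟨hγ, ?_, ?_, key, fun p => ?_⟩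
  · obtain ⟨α, -, hα⟩ := key (ε γ)
    exact ⟨α, hα⟩
  · intro h
    exact hF.ne_univ (Set.univ_subset_iff.1 (h ▸ Set.sdiff_subset))
  · obtain ⟨α, h, h'⟩ := hF.fibre_notMem p
    exact ⟨α, h, fun h'' => h' h''.1⟩

end Weighted

/-! ### Full heaps are weighted -/

section Full

variable {P E : Type*} [PartialOrder E] {A : Matrix P P ℤ} {ε : E → P}

theorem Concurs.symm {p q : P} (h : Concurs A p q) : Concurs A q p :=
  h.imp Eq.symm SimpleGraph.Adj.symm

theorem IsGCM.adj_iff (hA : IsGCM A) {p q : P} : (dynkinGraph A).Adj p q ↔ p ≠ q ∧ A p q ≠ 0 := by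
  have := hA.zero_symm p q
  simp only [dynkinGraph, SimpleGraph.fromRel_adj]
  tauto

theorem IsGCM.apply_neg (hA : IsGCM A) {p q : P} (h : (dynkinGraph A).Adj p q) : A p q < 0 :=
  lt_of_le_of_ne (hA.nonpos p q h.ne) (hA.adj_iff.1 h).2

/-- The order is generated by comparabilities between concurring labels, so `z` is the end of the
first strict step in a chain from `α` to `β`. -/
theorem IsHeap.exists_above (h : IsHeap A ε) {α β : E} (hlt : α < β) :
    ∃ z, α < z ∧ z ≤ β ∧ Concurs A (ε α) (ε z) := by
  have ht := (h.le_iff_transGen α β).1 hlt.le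
  induction ht using Relation.TransGen.head_induction_on with
  | single h' => exact ⟨β, hlt, le_rfl, h'.2⟩
  | @head a c h₁ h₂ ih =>
    have hcβ : c ≤ β := (h.le_iff_transGen c β).2 h₂
    rcases h₁.1.eq_or_lt with rfl | hac
    · exact ih hlt
    · exact ⟨c, hac, hcβ, h₁.2⟩

theorem IsHeap.exists_below (h : IsHeap A ε) {α β : E} (hlt : α < β) :
    ∃ z, α ≤ z ∧ z < β ∧ Concurs A (ε z) (ε β) := by
  have ht := (h.le_iff_transGen α β).1 hlt.le
  induction ht with
  | single h' => exact ⟨α, le_rfl, hlt, h'.2⟩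
  | @tail b c h₁ h₂ ih =>
    have hαb : α ≤ b := (h.le_iff_transGen α b).2 h₁
    rcases h₂.1.eq_or_lt with rfl | hbc
    · exact ih hlt
    · exact ⟨b, hαb, hbc, h₂.2⟩

theorem IsHeap.concurs_of_covBy (h : IsHeap A ε) {α β : E} (hc : α ⋖ β) :
    Concurs A (ε α) (ε β) := by
  obtain ⟨z, h₁, h₂, h₃⟩ := h.exists_above hc.lt
  rcases h₂.eq_or_lt with rfl | h₂
  · exact h₃
  · exact absurd h₂ (hc.2 h₁)

theorem IsHeap.chain (h : IsHeap A ε) (α β : E) (hl : ε α = ε β) : α ≤ β ∨ β ≤ α :=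
  h.comparable α β (Or.inl hl)

variable [LocallyFiniteOrder E]

/-- In a locally finite poset, a fibre that is a chain without lower end and comparable to `α`
reaches below `α`. -/
theorem exists_lt_of_unbounded {ε : E → P} (hu : ∀ α, ∃ β, ε β = ε α ∧ β < α) {p : P} {α δ : E}
    (hδ : ε δ = p) (hc : ∀ β, ε β = p → α ≤ β ∨ β ≤ α) : ∃ β, ε β = p ∧ β < α := by
  classical
  by_contra! hcon
  have hge : ∀ β, ε β = p → α ≤ β := fun β hβ => by
    rcases hc β hβ with h | h
    · exact h
    · exact (h.eq_or_lt.resolve_right (hcon β hβ)).ge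
  obtain ⟨m, hm⟩ := ((Finset.Icc α δ).filter (ε · = p)).exists_minimal
    ⟨δ, by simp [hδ, hge δ hδ]⟩
  have hm' := hm.1
  simp only [Finset.mem_filter, Finset.mem_Icc] at hm'
  obtain ⟨β, hβ, hlt⟩ := hu m
  have hβp := hβ.trans hm'.2
  exact hlt.not_ge (hm.2 (by simp [hβp, hge β hβp, hlt.le.trans hm'.1.2]) hlt.le)

theorem exists_gt_of_unbounded {ε : E → P} (hu : ∀ α, ∃ β, ε β = ε α ∧ α < β) {p : P} {α δ : E}
    (hδ : ε δ = p) (hc : ∀ β, ε β = p → α ≤ β ∨ β ≤ α) : ∃ β, ε β = p ∧ α < β :=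
  exists_lt_of_unbounded (E := Eᵒᵈ) hu (α := OrderDual.toDual α) (δ := OrderDual.toDual δ)
    hδ fun β hβ => (hc β hβ).symm

/-- Adjacent fibres are comparable with each other, so one can descend along a walk in the connected
diagram. -/
theorem IsFibred.exists_lt (h : IsFibred A ε) (hA : (dynkinGraph A).Connected) (α : E) (p : P) :
    ∃ β, ε β = p ∧ β < α := by
  obtain ⟨w⟩ := hA.preconnected (ε α) p
  generalize hq : ε α = q at w
  induction w generalizing α with
  | nil =>
    obtain ⟨β, h₁, h₂⟩ := h.unbounded_below α
    exact ⟨β, h₁.trans hq, h₂⟩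
  | @cons u v w hadj _ ih =>
    obtain ⟨δ, hδ⟩ := h.fibre_nonempty v
    obtain ⟨β, hβ, hlt⟩ := exists_lt_of_unbounded h.unbounded_below hδ (α := α) fun β hβ =>
      h.heap.comparable α β (Or.inr (by rwa [hq, hβ]))
    obtain ⟨γ, hγ, hlt'⟩ := ih β hβ
    exact ⟨γ, hγ, hlt'.trans hlt⟩

theorem IsFibred.exists_gt (h : IsFibred A ε) (hA : (dynkinGraph A).Connected) (α : E) (p : P) :
    ∃ β, ε β = p ∧ α < β := by
  obtain ⟨w⟩ := hA.preconnected (ε α) p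
  generalize hq : ε α = q at w
  induction w generalizing α with
  | nil =>
    obtain ⟨β, h₁, h₂⟩ := h.unbounded_above α
    exact ⟨β, h₁.trans hq, h₂⟩
  | @cons u v w hadj _ ih =>
    obtain ⟨δ, hδ⟩ := h.fibre_nonempty v
    obtain ⟨β, hβ, hlt⟩ := exists_gt_of_unbounded h.unbounded_above hδ (α := α) fun β hβ =>
      h.heap.comparable α β (Or.inr (by rwa [hq, hβ]))
    obtain ⟨γ, hγ, hlt'⟩ := ih β hβ
    exact ⟨γ, hγ, hlt.trans hlt'⟩

theorem IsFibred.isProperIdeal_Iic (h : IsFibred A ε) (hA : (dynkinGraph A).Connected) (α : E) :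
    IsProperIdeal ε (Set.Iic α) where
  isLowerSet := isLowerSet_Iic α
  nonempty := ⟨α, le_rfl⟩
  ne_univ hne := by
    obtain ⟨β, -, hβ⟩ := h.exists_gt hA α (ε α)
    exact hβ.not_ge (hne ▸ Set.mem_univ β : β ∈ Set.Iic α)
  fibre_mem p := (h.exists_lt hA α p).imp fun _ hβ => ⟨hβ.1, hβ.2.le⟩
  fibre_notMem p := (h.exists_gt hA α p).imp fun _ hβ => ⟨hβ.1, hβ.2.not_ge⟩

/-- A proper ideal cuts each fibre between two consecutive elements. -/
theorem exists_consecutive {ε : E → P} (hc : ∀ α β, ε α = ε β → α ≤ β ∨ β ≤ α) {F : Set E}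
    (hF : IsProperIdeal ε F) (i : P) :
    ∃ α β, ε α = i ∧ ε β = i ∧ α ∈ F ∧ β ∉ F ∧ α < β ∧
      ∀ γ ∈ Finset.Ioo α β, ε γ ≠ i := by
  classical
  have lt_of : ∀ a b, ε a = i → ε b = i → a ∈ F → b ∉ F → a < b := fun a b ha hb haF hbF =>
    lt_of_le_of_ne ((hc a b (ha.trans hb.symm)).resolve_right fun h =>
      hbF (hF.isLowerSet h haF)) fun h => hbF (h ▸ haF)
  obtain ⟨a, ha, haF⟩ := hF.fibre_mem i
  obtain ⟨b, hb, hbF⟩ := hF.fibre_notMem i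
  have hab := lt_of a b ha hb haF hbF
  obtain ⟨α, hα⟩ := ((Finset.Icc a b).filter fun γ => ε γ = i ∧ γ ∈ F).exists_maximal
    ⟨a, by simp [ha, haF, hab.le]⟩
  have hα' := hα.1
  simp only [Finset.mem_filter, Finset.mem_Icc] at hα'
  obtain ⟨β, hβ⟩ := ((Finset.Icc α b).filter fun γ => ε γ = i ∧ γ ∉ F).exists_minimal
    ⟨b, by simp [hb, hbF, hα'.1.2]⟩
  have hβ' := hβ.1
  simp only [Finset.mem_filter, Finset.mem_Icc] at hβ'
  refine ⟨α, β, hα'.2.1, hβ'.2.1, hα'.2.2, hβ'.2.2,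
    lt_of _ _ hα'.2.1 hβ'.2.1 hα'.2.2 hβ'.2.2, fun γ hγ hγi => ?_⟩
  rw [Finset.mem_Ioo] at hγ
  by_cases hγF : γ ∈ F
  · refine hγ.1.not_ge (hα.2 ?_ hγ.1.le)
    simp [hγi, hγF, hα'.1.1.trans hγ.1.le, hγ.2.le.trans hβ'.1.2]
  · refine hγ.2.not_ge (hβ.2 ?_ hγ.2.le)
    simp [hγi, hγF, hγ.1.le, hγ.2.le.trans hβ'.1.2]

section Cut

variable {F : Set E} {i : P} {α β : E}

open Classical in
-- Only `α` can be removed, and what blocks it is an element of `F` above it. By `exists_above` a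
-- blocking element may be taken with label adjacent to `i`, and it then lies below `β`. All terms
-- of the sum are nonpositive, so a zero sum rules this out.
theorem IsHeap.removable_nonempty_iff (h : IsHeap A ε) (hA : IsGCM A) (hF : IsLowerSet F)
    (hα : ε α = i) (hβ : ε β = i) (hαF : α ∈ F) (hβF : β ∉ F)
    (hcons : ∀ γ ∈ Finset.Ioo α β, ε γ ≠ i) :
    (removable ε i F).Nonempty ↔ ∑ γ ∈ Finset.Ioo α β with γ ∈ F, A i (ε γ) = 0 := by
  constructor
  · rintro ⟨γ, hγ, hγF, hlow⟩
    have hγβ : γ < β := lt_of_le_of_ne ((h.chain γ β (hγ.trans hβ.symm)).resolve_right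
      fun h' => hβF (hF h' hγF)) fun h' => hβF (h' ▸ hγF)
    have hγα : γ = α := by
      rcases h.chain γ α (hγ.trans hα.symm) with h' | h'
      · by_contra hne
        exact (hlow h' ⟨hαF, fun h'' => hne h''.symm⟩).2 rfl
      · by_contra hne
        exact hcons γ (by simp [hγβ, lt_of_le_of_ne h' (Ne.symm hne)]) hγ
    subst hγα
    rw [Finset.filter_eq_empty_iff.2, Finset.sum_empty]
    intro z hz hzF
    rw [Finset.mem_Ioo] at hz
    exact (hlow hz.1.le ⟨hzF, hz.1.ne'⟩).2 rfl
  · intro hsum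
    refine ⟨α, hα, hαF, fun u v hvu hu => ⟨hF hvu hu.1, ?_⟩⟩
    rintro rfl
    obtain ⟨z, hvz, hzu, hcon⟩ := h.exists_above (lt_of_le_of_ne hvu (Ne.symm hu.2))
    have hzF := hF hzu hu.1
    have hzβ : z < β := lt_of_le_of_ne ((h.comparable z β (by rw [hβ, ← hα]; exact hcon.symm)
      ).resolve_right fun h' => hβF (hF h' hzF)) fun h' => hβF (h' ▸ hzF)
    have hmem : z ∈ Finset.Ioo v β := by simp [hvz, hzβ]
    have hneg : A i (ε z) < 0 := hA.apply_neg
      ((hα ▸ hcon : Concurs A i (ε z)).resolve_left (hcons z hmem).symm)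
    refine (Finset.sum_neg' (fun w hw => ?_) ⟨z, Finset.mem_filter.2 ⟨hmem, hzF⟩, hneg⟩).ne hsum
    exact hA.nonpos _ _ (hcons w (Finset.mem_filter.1 hw).1).symm

open Classical in
theorem IsHeap.addable_nonempty_iff (h : IsHeap A ε) (hA : IsGCM A) (hF : IsLowerSet F)
    (hα : ε α = i) (hβ : ε β = i) (hαF : α ∈ F) (hβF : β ∉ F)
    (hcons : ∀ γ ∈ Finset.Ioo α β, ε γ ≠ i) :
    (addable ε i F).Nonempty ↔ ∑ γ ∈ Finset.Ioo α β with γ ∉ F, A i (ε γ) = 0 := by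
  constructor
  · rintro ⟨γ, hγ, hγF, hlow⟩
    have hαγ : α < γ := lt_of_le_of_ne ((h.chain α γ (hα.trans hγ.symm)).resolve_right
      fun h' => hγF (hF h' hαF)) fun h' => hγF (h' ▸ hαF)
    have hγβ : γ = β := by
      rcases h.chain β γ (hβ.trans hγ.symm) with h' | h'
      · by_contra hne
        exact (hlow h' (Or.inr rfl)).elim hβF fun h'' => hne h''.symm
      · by_contra hne
        exact hcons γ (by simp [hαγ, lt_of_le_of_ne h' hne]) hγ
    subst hγβ
    rw [Finset.filter_eq_empty_iff.2, Finset.sum_empty]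
    intro z hz hzF
    rw [Finset.mem_Ioo] at hz
    exact (hlow hz.2.le (Or.inr rfl)).elim hzF hz.2.ne
  · intro hsum
    refine ⟨β, hβ, hβF, ?_⟩
    rintro u v hvu (hu | rfl)
    · exact Or.inl (hF hvu hu)
    by_contra hv
    simp only [Set.mem_union, Set.mem_singleton_iff, not_or] at hv
    obtain ⟨z, hvz, hzu, hcon⟩ := h.exists_below (lt_of_le_of_ne hvu hv.2)
    have hzF : z ∉ F := fun h' => hv.1 (hF hvz h')
    have hαz : α < z := lt_of_le_of_ne ((h.comparable α z (by rw [hα, ← hβ]; exact hcon.symm)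
      ).resolve_right fun h' => hzF (hF h' hαF)) fun h' => hzF (h' ▸ hαF)
    have hmem : z ∈ Finset.Ioo α u := by simp [hαz, hzu]
    have hneg : A i (ε z) < 0 := hA.apply_neg
      ((hβ ▸ hcon.symm : Concurs A i (ε z)).resolve_left (hcons z hmem).symm)
    refine (Finset.sum_neg' (fun w hw => ?_) ⟨z, Finset.mem_filter.2 ⟨hmem, hzF⟩, hneg⟩).ne hsum
    exact hA.nonpos _ _ (hcons w (Finset.mem_filter.1 hw).1).symm

open Classical in
theorem IsFull.sum_filter_add (h : IsFull A ε) (hα : ε α = i) (hβ : ε β = i) (hαβ : α < β)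
    (hcons : ∀ γ ∈ Finset.Ioo α β, ε γ ≠ i) :
    ∑ γ ∈ Finset.Ioo α β with γ ∈ F, A i (ε γ) + ∑ γ ∈ Finset.Ioo α β with γ ∉ F, A i (ε γ)
      = -2 := by
  subst hα
  rw [Finset.sum_filter_add_sum_filter_not]
  exact h.sum_Ioo α β hαβ hβ.symm hcons

open Classical in
-- The total `-2` splits into two nonpositive integers, the parts inside and outside `F`. The inside
-- part is `0`, `-1` or `-2`: removable, neither, or addable.
theorem IsFull.weight_eq (h : IsFull A ε) (hA : IsGCM A) (hF : IsLowerSet F)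
    (hα : ε α = i) (hβ : ε β = i) (hαF : α ∈ F) (hβF : β ∉ F) (hαβ : α < β)
    (hcons : ∀ γ ∈ Finset.Ioo α β, ε γ ≠ i) :
    weight ε i F = 1 + ∑ γ ∈ Finset.Ioo α β with γ ∈ F, A i (ε γ) := by
  have h₁ := h.fibred.heap.removable_nonempty_iff hA hF hα hβ hαF hβF hcons
  have h₂ := h.fibred.heap.addable_nonempty_iff hA hF hα hβ hαF hβF hcons
  have h₃ := h.sum_filter_add (F := F) hα hβ hαβ hcons
  have h₄ : ∑ γ ∈ Finset.Ioo α β with γ ∈ F, A i (ε γ) ≤ 0 := Finset.sum_nonpos fun w hw =>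
    hA.nonpos _ _ (hcons w (Finset.mem_filter.1 hw).1).symm
  have h₅ : ∑ γ ∈ Finset.Ioo α β with γ ∉ F, A i (ε γ) ≤ 0 := Finset.sum_nonpos fun w hw =>
    hA.nonpos _ _ (hcons w (Finset.mem_filter.1 hw).1).symm
  rw [weight, if_congr h₁ rfl rfl, if_congr h₂ rfl rfl]
  split_ifs <;> omega

end Cut

theorem IsFull.not_both (h : IsFull A ε) (hA : IsGCM A) (i : P) {F : Set E}
    (hF : IsProperIdeal ε F) (ha : (addable ε i F).Nonempty) : ¬ (removable ε i F).Nonempty := by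
  classical
  intro hr
  obtain ⟨α, β, hα, hβ, hαF, hβF, hαβ, hcons⟩ := exists_consecutive h.fibred.heap.chain hF i
  have h₁ := (h.fibred.heap.removable_nonempty_iff hA hF.isLowerSet hα hβ hαF hβF hcons).1 hr
  have h₂ := (h.fibred.heap.addable_nonempty_iff hA hF.isLowerSet hα hβ hαF hβF hcons).1 ha
  have h₃ := h.sum_filter_add (F := F) hα hβ hαβ hcons
  omega

theorem IsFull.weight_insert (h : IsFull A ε) (hA : IsGCM A) (i : P) {F : Set E} {γ : E}
    (hF : IsProperIdeal ε F) (hγ : γ ∉ F) (hlow : IsLowerSet (F ∪ {γ})) :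
    weight ε i (F ∪ {γ}) = weight ε i F + A i (ε γ) := by
  classical
  have hF' := isProperIdeal_union_singleton h.fibred.unbounded_above hF hlow
  -- If `γ` itself has label `i`, the weight passes from `-1` to `1`, in agreement with `a_{ii} =
  -- 2`. Otherwise the cut of the fibre of `i` is the same for both ideals.
  by_cases hi : ε γ = i
  · have ha : (addable ε i F).Nonempty := ⟨γ, hi, hγ, hlow⟩
    have hr : (removable ε i (F ∪ {γ})).Nonempty := by
      refine ⟨γ, hi, Or.inr rfl, ?_⟩
      rw [Set.union_sdiff_cancel_right (by simpa using hγ)]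
      exact hF.isLowerSet
    have hr' := h.not_both hA i hF ha
    have ha' : ¬ (addable ε i (F ∪ {γ})).Nonempty := fun ha' => h.not_both hA i hF' ha' hr
    simp only [weight, ha, hr, hr', ha', if_true, if_false, hi, hA.diag]
    norm_num
  · obtain ⟨α, β, hα, hβ, hαF, hβF, hαβ, hcons⟩ := exists_consecutive h.fibred.heap.chain hF i
    have hβF' : β ∉ F ∪ {γ} := by
      rintro (h' | h')
      · exact hβF h'
      · exact hi (h' ▸ hβ)
    rw [h.weight_eq hA hF.isLowerSet hα hβ hαF hβF hαβ hcons,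
      h.weight_eq hA hlow hα hβ (Or.inl hαF) hβF' hαβ hcons]
    -- An element with label adjacent to `i` is comparable to `α` and `β`, and being added to `F` it
    -- is squeezed between them.
    have hz : γ ∉ Finset.Ioo α β → A i (ε γ) = 0 := by
      intro hn
      by_contra hne
      have hcon : Concurs A i (ε γ) := Or.inr (hA.adj_iff.2 ⟨Ne.symm hi, hne⟩)
      refine hn (Finset.mem_Ioo.2 ⟨?_, ?_⟩)
      · exact lt_of_le_of_ne ((h.fibred.heap.comparable α γ (hα ▸ hcon)).resolve_right
          fun h' => hγ (hF.isLowerSet h' hαF)) fun h' => hγ (h' ▸ hαF)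
      · exact lt_of_le_of_ne ((h.fibred.heap.comparable β γ (hβ ▸ hcon)).resolve_left
          fun h' => hβF' (hlow h' (Or.inr rfl))) fun h' => hβF' (h' ▸ Or.inr rfl)
    obtain ⟨G, hG⟩ : ∃ G, G = F ∪ {γ} := ⟨_, rfl⟩
    have hγG : γ ∈ G := hG ▸ Or.inr rfl
    have hfil : ∀ s : Finset E, γ ∉ s →
        ∑ x ∈ s with x ∈ G, A i (ε x) = ∑ x ∈ s with x ∈ F, A i (ε x) := fun s hs => by
      refine Finset.sum_congr (Finset.filter_congr fun x hx => ?_) fun _ _ => rfl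
      have : x ≠ γ := fun h => hs (h ▸ hx)
      simp [hG, this]
    rw [← hG]
    by_cases hm : γ ∈ Finset.Ioo α β
    · rw [← Finset.insert_erase hm, Finset.filter_insert, Finset.filter_insert, if_neg hγ,
        if_pos hγG, Finset.sum_insert (by simp), hfil _ (Finset.notMem_erase _ _)]
      ring
    · rw [hz hm, hfil _ hm, add_zero]

theorem IsFull.isWeighted (h : IsFull A ε) (hA : IsGCM A) (hc : (dynkinGraph A).Connected) :
    IsWeighted A ε where
  chain := h.fibred.heap.chain
  unbounded_above := h.fibred.unbounded_above
  unbounded_below := h.fibred.unbounded_below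
  exists_proper i := (h.fibred.fibre_nonempty i).imp fun α hα =>
    ⟨hα, h.fibred.isProperIdeal_Iic hc α⟩
  not_both i _ hF := h.not_both hA i hF
  weight_insert i _ _ hF hγ hlow := h.weight_insert hA i hF hγ hlow

end Full

/-! ### Folded full heaps are weighted -/

section Folded

variable {P Q E : Type*} {A : Matrix P P ℤ} {A₀ : Matrix Q Q ℤ} {μ : Equiv.Perm Q} {f : Q → P}

theorem Folds.apply_apply (h : Folds A₀ μ f A) (p : Q) : μ (μ p) = p := by
  have := pow_orderOf_eq_one μ
  rw [h.order_two, pow_two] at this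
  rw [← Equiv.Perm.mul_apply, this, Equiv.Perm.one_apply]

open Classical in
/-- The sum of a function over the orbit of `p` under an involution `μ`. -/
noncomputable def orbitSum (μ : Equiv.Perm Q) (g : Q → ℤ) (p : Q) : ℤ :=
  g p + if μ p = p then 0 else g (μ p)

/-- Since `A₀` is simply laced, the sum over the orbit counts, up to sign, the edges from `q` to the
orbit of `p`; on the diagonal the second term vanishes because `p` and `μ p` are not adjacent. -/
theorem Folds.entry_eq (h : Folds A₀ μ f A) (hA : IsGCM A₀) (hs : IsSimplyLaced A₀) (p q : Q) :
    A (f p) (f q) = orbitSum μ (A₀ · q) p := by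
  have hadj : ∀ a b, (dynkinGraph A₀).Adj a b → A₀ a b = -1 := fun a b hab => by
    have h₁ := hA.apply_neg hab
    have h₂ := hs a b
    rcases hA.doublyLaced a b with h | h | h | h <;> omega
  have hnadj : ∀ a b, a ≠ b → ¬ (dynkinGraph A₀).Adj a b → A₀ a b = 0 := fun a b hne hab => by
    by_contra h0
    exact hab (hA.adj_iff.2 ⟨hne, h0⟩)
  have hself : ∀ a, μ a ≠ a → A₀ a (μ a) = 0 := fun a ha => hnadj _ _ ha.symm (h.not_adj a)
  have hself' : ∀ a, μ a ≠ a → A₀ (μ a) a = 0 := fun a ha =>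
    hnadj _ _ ha fun hadj => h.not_adj a hadj.symm
  rw [orbitSum]
  by_cases hpq : f p = f q
  · rw [← hpq, h.diag]
    rcases (h.orbits p q).1 hpq with rfl | rfl
    · split_ifs with hm
      · rw [hA.diag, add_zero]
      · rw [hA.diag, hself' _ hm, add_zero]
    · split_ifs with hm
      · rw [hm, hA.diag, add_zero]
      · rw [hA.diag, hself _ hm, zero_add]
  · have hfμ : f (μ p) = f p := ((h.orbits p (μ p)).2 (Or.inr rfl)).symm
    have hne : p ≠ q := fun h' => hpq (h' ▸ rfl)
    have hne' : μ p ≠ q := fun h' => hpq (h' ▸ hfμ.symm)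
    by_cases h₁ : (dynkinGraph A₀).Adj p q <;> by_cases h₂ : (dynkinGraph A₀).Adj (μ p) q <;>
      split_ifs with hm
    · rw [h.entry_single p q hpq h₁ fun h' => h'.1 hm.symm, hadj _ _ h₁, add_zero]
    · rw [h.entry_double p q hpq (Ne.symm hm) h₁ h₂, hadj _ _ h₁, hadj _ _ h₂]
      norm_num
    · exact absurd (hm.symm ▸ h₁) h₂
    · rw [h.entry_single p q hpq h₁ fun h' => h₂ h'.2, hadj _ _ h₁, hnadj _ _ hne' h₂, add_zero]
    · exact absurd (hm ▸ h₂) h₁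
    -- Only `μ p` is joined to `q`, so it serves as the representative of the orbit.
    · have := h.entry_single (μ p) q (hfμ ▸ hpq) h₂ fun h' => h₁ (h.apply_apply p ▸ h'.2)
      rw [← hfμ, this, hadj _ _ h₂, hnadj _ _ hne h₁, zero_add]
    · rw [h.entry_zero p q hpq h₁ h₂, hnadj _ _ hne h₁, add_zero]
    · rw [h.entry_zero p q hpq h₁ h₂, hnadj _ _ hne h₁, hnadj _ _ hne' h₂, add_zero]

variable [PartialOrder E] {ε : E → Q}

theorem Folds.removable_eq (h : Folds A₀ μ f A) (p : Q) (F : Set E) :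
    removable (f ∘ ε) (f p) F = removable ε p F ∪ removable ε (μ p) F := by
  ext γ
  have := h.orbits p (ε γ)
  simp only [removable, Set.mem_ofPred_eq, Set.mem_union, Function.comp]
  rw [eq_comm (a := f (ε γ)), this]
  tauto

theorem Folds.addable_eq (h : Folds A₀ μ f A) (p : Q) (F : Set E) :
    addable (f ∘ ε) (f p) F = addable ε p F ∪ addable ε (μ p) F := by
  ext γ
  have := h.orbits p (ε γ)
  simp only [addable, Set.mem_ofPred_eq, Set.mem_union, Function.comp]
  rw [eq_comm (a := f (ε γ)), this]
  tauto

section Cut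

variable {p q : Q} {F : Set E}

theorem not_addable_and_addable (hc : ∀ α β : E, ε α = p → ε β = q → α ≤ β ∨ β ≤ α)
    (hpq : p ≠ q) (h₁ : (addable ε p F).Nonempty) : ¬ (addable ε q F).Nonempty := by
  rintro ⟨β, hβ, hβF, hβl⟩
  obtain ⟨α, hα, hαF, hαl⟩ := h₁
  have hne : α ≠ β := fun h => hpq (hα.symm.trans (h ▸ hβ))
  rcases hc α β hα hβ with h | h
  · exact (hβl h (Or.inr rfl)).elim hαF hne
  · exact (hαl h (Or.inr rfl)).elim hβF hne.symm

theorem not_removable_and_removable (hc : ∀ α β : E, ε α = p → ε β = q → α ≤ β ∨ β ≤ α)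
    (hpq : p ≠ q) (h₁ : (removable ε p F).Nonempty) : ¬ (removable ε q F).Nonempty := by
  rintro ⟨β, hβ, hβF, hβl⟩
  obtain ⟨α, hα, hαF, hαl⟩ := h₁
  have hne : α ≠ β := fun h => hpq (hα.symm.trans (h ▸ hβ))
  rcases hc α β hα hβ with h | h
  · exact (hαl h ⟨hβF, hne.symm⟩).2 rfl
  · exact (hβl h ⟨hαF, hne⟩).2 rfl

/-- An addable and a removable element that are comparable form a covering pair, so that their
labels are adjacent or equal. -/
theorem IsHeap.concurs_of_addable_of_removable (h : IsHeap A₀ ε)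
    (hc : ∀ α β : E, ε α = p → ε β = q → α ≤ β ∨ β ≤ α) (hF : IsLowerSet F)
    (h₁ : (addable ε p F).Nonempty) (h₂ : (removable ε q F).Nonempty) : Concurs A₀ p q := by
  obtain ⟨β, rfl, hβF, hβl⟩ := h₁
  obtain ⟨α, rfl, hαF, hαl⟩ := h₂
  have hle : α ≤ β := (hc β α rfl rfl).resolve_left fun h' => hβF (hF h' hαF)
  refine (h.concurs_of_covBy ⟨lt_of_le_of_ne hle fun h' => hβF (h' ▸ hαF),
    fun x hx hx' => ?_⟩).symm
  have hxF : x ∈ F := (hβl hx'.le (Or.inr rfl)).resolve_right hx'.ne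
  exact (hαl hx.le ⟨hxF, hx.ne'⟩).2 rfl

end Cut

variable [LocallyFiniteOrder E]

/-- The fibres of `p` and `μ p` are mutually comparable and unbounded, so each has elements below
and above any element of the other. -/
theorem Folds.isProperIdeal_iff (h : Folds A₀ μ f A) (hε : IsFibred A₀ ε)
    (hc : ∀ α β : E, Concurs A₀ (μ (ε α)) (ε β) → α ≤ β ∨ β ≤ α) (F : Set E) :
    IsProperIdeal (f ∘ ε) F ↔ IsProperIdeal ε F := by
  constructor
  · intro hF
    refine ⟨hF.isLowerSet, hF.nonempty, hF.ne_univ, fun p => ?_, fun p => ?_⟩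
    · obtain ⟨α, hα, hαF⟩ := hF.fibre_mem (f p)
      rcases (h.orbits (ε α) p).1 hα with hp | hp
      · exact ⟨α, hp.symm, hαF⟩
      · obtain ⟨δ, hδ⟩ := hε.fibre_nonempty p
        obtain ⟨β, hβ, hlt⟩ := exists_lt_of_unbounded hε.unbounded_below hδ (α := α)
          fun β hβ => hc α β (Or.inl (hp.symm.trans hβ.symm))
        exact ⟨β, hβ, hF.isLowerSet hlt.le hαF⟩
    · obtain ⟨α, hα, hαF⟩ := hF.fibre_notMem (f p)
      rcases (h.orbits (ε α) p).1 hα with hp | hp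
      · exact ⟨α, hp.symm, hαF⟩
      · obtain ⟨δ, hδ⟩ := hε.fibre_nonempty p
        obtain ⟨β, hβ, hlt⟩ := exists_gt_of_unbounded hε.unbounded_above hδ (α := α)
          fun β hβ => hc α β (Or.inl (hp.symm.trans hβ.symm))
        exact ⟨β, hβ, fun hβF => hαF (hF.isLowerSet hlt.le hβF)⟩
  · intro hF
    refine ⟨hF.isLowerSet, hF.nonempty, hF.ne_univ, fun p => ?_, fun p => ?_⟩
    · obtain ⟨q, rfl⟩ := h.surjective p
      exact (hF.fibre_mem q).imp fun α hα => ⟨congrArg f hα.1, hα.2⟩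
    · obtain ⟨q, rfl⟩ := h.surjective p
      exact (hF.fibre_notMem q).imp fun α hα => ⟨congrArg f hα.1, hα.2⟩

variable (hf : Folds A₀ μ f A) (hA : IsGCM A₀) (h : IsFull A₀ ε)
  (hc : ∀ α β : E, Concurs A₀ (μ (ε α)) (ε β) → α ≤ β ∨ β ≤ α)

include hf hA h hc

theorem Folds.not_both {i : P} {F : Set E} (hF : IsProperIdeal ε F)
    (ha : (addable (f ∘ ε) i F).Nonempty) : ¬ (removable (f ∘ ε) i F).Nonempty := by
  obtain ⟨p, rfl⟩ := hf.surjective i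
  -- Such a pair would be a covering pair with labels `a` and `μ a`: these would be adjacent, which
  -- is excluded, or equal, which is the unfolded case.
  have hcon : ∀ a, (addable ε a F).Nonempty → ¬ (removable ε (μ a) F).Nonempty := by
    intro a ha hr
    rcases h.fibred.heap.concurs_of_addable_of_removable (fun α β hα hβ => hc α β (Or.inl
      (by rw [hα, hβ]))) hF.isLowerSet ha hr with h' | h'
    · exact h.not_both hA a hF ha (h' ▸ hr)
    · exact hf.not_adj a h'
  rw [hf.addable_eq, Set.union_nonempty] at ha
  rw [hf.removable_eq, Set.union_nonempty]
  rintro (hr | hr) <;> rcases ha with ha | ha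
  · exact h.not_both hA _ hF ha hr
  · exact hcon _ ha (by rwa [hf.apply_apply])
  · exact hcon _ ha hr
  · exact h.not_both hA _ hF ha hr

/-- For `p ≠ μ p`, comparability forbids two addable or two removable elements with labels `p` and
`μ p`, so the indicator of each union is the sum of the indicators. -/
theorem Folds.weight_eq (p : Q) {F : Set E} (hF : IsProperIdeal ε F) :
    weight (f ∘ ε) (f p) F = orbitSum μ (weight ε · F) p := by
  classical
  rw [orbitSum]
  have h₁ := fun ha hr => hf.not_both hA h hc (i := f p) hF ha hr
  split_ifs with hm
  · rw [weight, weight, hf.addable_eq, hf.removable_eq, hm, Set.union_self, Set.union_self,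
      add_zero]
  · have hcomp : ∀ α β : E, ε α = p → ε β = μ p → α ≤ β ∨ β ≤ α := fun α β hα hβ =>
      hc α β (Or.inl (by rw [hα, hβ]))
    have h₂ := not_addable_and_addable (F := F) hcomp (Ne.symm hm)
    have h₃ := not_removable_and_removable (F := F) hcomp (Ne.symm hm)
    simp only [weight, hf.addable_eq, hf.removable_eq, Set.union_nonempty] at h₁ ⊢
    split_ifs <;> first | rfl | (exfalso; tauto)

theorem Folds.isWeighted (hs : IsSimplyLaced A₀) (hconn : (dynkinGraph A₀).Connected) :
    IsWeighted A (f ∘ ε) where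
  chain α β hαβ := by
    rcases (hf.orbits _ _).1 hαβ with h' | h'
    · exact h.fibred.heap.chain α β h'.symm
    · exact hc α β (Or.inl h'.symm)
  unbounded_above α := (h.fibred.unbounded_above α).imp fun β hβ => ⟨congrArg f hβ.1, hβ.2⟩
  unbounded_below α := (h.fibred.unbounded_below α).imp fun β hβ => ⟨congrArg f hβ.1, hβ.2⟩
  exists_proper i := by
    obtain ⟨p, rfl⟩ := hf.surjective i
    exact (h.fibred.fibre_nonempty p).imp fun α hα => ⟨congrArg f hα,
      (hf.isProperIdeal_iff h.fibred hc _).2 (h.fibred.isProperIdeal_Iic hconn α)⟩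
  not_both i F hF := hf.not_both hA h hc ((hf.isProperIdeal_iff h.fibred hc F).1 hF)
  weight_insert i F γ hF hγ hlow := by
    obtain ⟨p, rfl⟩ := hf.surjective i
    rw [hf.isProperIdeal_iff h.fibred hc] at hF
    have hF' := isProperIdeal_union_singleton h.fibred.unbounded_above hF hlow
    rw [hf.weight_eq hA h hc p hF, hf.weight_eq hA h hc p hF', Function.comp_apply,
      hf.entry_eq hA hs, orbitSum, orbitSum, orbitSum, h.weight_insert hA _ hF hγ hlow,
      h.weight_insert hA _ hF hγ hlow]
    split_ifs <;> ring

end Folded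

theorem IsSimplyFoldedFull.isWeighted {P E : Type*} [Fintype P] [PartialOrder E]
    [LocallyFiniteOrder E] {A : Matrix P P ℤ} (hA : IsAffine A) {ε : E → P}
    (hE : IsSimplyFoldedFull A ε) : IsWeighted A ε := by
  rcases hE with h | ⟨Q, _, A₀, μ, f, ε₀, hA₀, hs, hf, h, hc, rfl⟩
  · exact h.isWeighted hA.gcm hA.indecomposable
  · exact hf.isWeighted hA₀.gcm h hc hs hA₀.indecomposable

/-! ### Characters: additivity, injectivity, relation with weights -/

section SignedCard

variable {E : Type*}

/-- Inside a common finite window `U` the signed count is a difference of two cardinals; this makes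
`character_add` telescope although the ideals are infinite. -/
theorem ncard_sdiff_sub_ncard_sdiff {A B U : Set E} (hU : U.Finite) (h₁ : A \ B ⊆ U)
    (h₂ : B \ A ⊆ U) :
    ((B \ A).ncard : ℤ) - (A \ B).ncard = (B ∩ U).ncard - (A ∩ U).ncard := by
  have hA : (A ∩ U).Finite := hU.subset Set.inter_subset_right
  have hB : (B ∩ U).Finite := hU.subset Set.inter_subset_right
  have e₁ : B \ A = (B ∩ U) \ (A ∩ U) := by
    ext x
    have := @h₂ x
    simp only [Set.mem_sdiff, Set.mem_inter_iff] at *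
    tauto
  have e₂ : A \ B = (A ∩ U) \ (B ∩ U) := by
    ext x
    have := @h₁ x
    simp only [Set.mem_sdiff, Set.mem_inter_iff] at *
    tauto
  rw [e₁, e₂]
  have k₁ := Set.ncard_inter_add_ncard_sdiff_eq_ncard (B ∩ U) (A ∩ U) hB
  have k₂ := Set.ncard_inter_add_ncard_sdiff_eq_ncard (A ∩ U) (B ∩ U) hA
  rw [Set.inter_comm] at k₂
  omega

end SignedCard

section Character

variable {P E : Type*} [PartialOrder E] {A : Matrix P P ℤ} {ε : E → P}

theorem character_self (F : ProperIdeal ε) : character ε F F = 0 := by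
  ext p
  simp [character]

theorem character_swap (F F' : ProperIdeal ε) : character ε F' F = -character ε F F' := by
  ext p
  simp [character]

theorem character_insert [DecidableEq P] {F F' : ProperIdeal ε} {γ : E} (hγ : γ ∉ F.1)
    (h : F'.1 = F.1 ∪ {γ}) : character ε F F' = Pi.single (ε γ) 1 := by
  have h₁ : F'.1 \ F.1 = {γ} := by
    rw [h]
    ext x
    simp only [Set.mem_sdiff, Set.mem_union, Set.mem_singleton_iff]
    exact ⟨fun h' => h'.1.resolve_left h'.2, fun h' => ⟨Or.inr h', h' ▸ hγ⟩⟩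
  have h₂ : F.1 \ F'.1 = ∅ := by
    rw [h]
    exact Set.sdiff_eq_empty.2 Set.subset_union_left
  ext p
  rw [character, h₁, h₂]
  by_cases hp : p = ε γ
  · subst hp
    rw [Set.inter_eq_right.2 (by simp)]
    simp
  · have : {α | ε α = p} ∩ {γ} = ∅ := by
      simpa using fun h' : ε γ = p => hp h'.symm
    rw [this]
    simp [hp]

theorem fibre_total (hc : ∀ α β, ε α = ε β → α ≤ β ∨ β ≤ α) {F F' : Set E} (hF : IsLowerSet F)
    (hF' : IsLowerSet F') (p : P) :
    {α | ε α = p} ∩ (F \ F') = ∅ ∨ {α | ε α = p} ∩ (F' \ F) = ∅ := by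
  by_contra! h
  obtain ⟨⟨a, ha, haF, haF'⟩, b, hb, hbF', hbF⟩ := h
  rcases hc a b (Eq.trans ha (Eq.symm hb)) with h | h
  · exact haF' (hF' h hbF')
  · exact hbF (hF h haF)

theorem IsWeighted.isProperIdeal_inter (h : IsWeighted A ε) (F F' : ProperIdeal ε) :
    IsProperIdeal ε (F.1 ∩ F'.1) := by
  have key : ∀ p, ∃ α, ε α = p ∧ α ∈ F.1 ∩ F'.1 := by
    intro p
    obtain ⟨a, ha, haF⟩ := F.2.fibre_mem p
    obtain ⟨b, hb, hbF⟩ := F'.2.fibre_mem p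
    rcases h.chain a b (ha.trans hb.symm) with h' | h'
    · exact ⟨a, ha, haF, F'.2.isLowerSet h' hbF⟩
    · exact ⟨b, hb, F.2.isLowerSet h' haF, hbF⟩
  refine ⟨F.2.isLowerSet.inter F'.2.isLowerSet, ?_, fun h' => ?_, key, fun p => ?_⟩
  · obtain ⟨a, -⟩ := F.2.nonempty
    obtain ⟨α, -, hα⟩ := key (ε a)
    exact ⟨α, hα⟩
  · exact F.2.ne_univ (Set.univ_subset_iff.1 (h' ▸ Set.inter_subset_left))
  · exact (F.2.fibre_notMem p).imp fun α hα => ⟨hα.1, fun h' => hα.2 h'.1⟩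

variable [LocallyFiniteOrder E]

theorem IsWeighted.finite_fibre_sdiff (h : IsWeighted A ε) (F F' : ProperIdeal ε) (p : P) :
    ({α | ε α = p} ∩ (F.1 \ F'.1)).Finite := by
  obtain ⟨a, ha, haF'⟩ := F'.2.fibre_mem p
  obtain ⟨b, hb, hbF⟩ := F.2.fibre_notMem p
  refine (Set.finite_Icc a b).subset ?_
  rintro x ⟨hx, hxF, hxF'⟩
  exact ⟨(h.chain a x (ha.trans (Eq.symm hx))).resolve_right fun h' =>
      hxF' (F'.2.isLowerSet h' haF'),
    (h.chain x b (Eq.trans hx hb.symm)).resolve_right fun h' => hbF (F.2.isLowerSet h' hxF)⟩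

theorem IsWeighted.character_add (h : IsWeighted A ε) (F G H : ProperIdeal ε) :
    character ε F G + character ε G H = character ε F H := by
  ext p
  have hfin := fun X Y : ProperIdeal ε => h.finite_fibre_sdiff X Y p
  set U := ({α | ε α = p} ∩ (F.1 \ G.1)) ∪ ({α | ε α = p} ∩ (G.1 \ F.1)) ∪
    (({α | ε α = p} ∩ (G.1 \ H.1)) ∪ ({α | ε α = p} ∩ (H.1 \ G.1))) with hU
  have hUf : U.Finite := ((hfin F G).union (hfin G F)).union ((hfin G H).union (hfin H G))
  have key : ∀ X Y : ProperIdeal ε, {α | ε α = p} ∩ (X.1 \ Y.1) ⊆ U →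
      {α | ε α = p} ∩ (Y.1 \ X.1) ⊆ U → character ε X Y p =
        (({α | ε α = p} ∩ Y.1) ∩ U).ncard - (({α | ε α = p} ∩ X.1) ∩ U).ncard := by
    intro X Y hXY hYX
    rw [← ncard_sdiff_sub_ncard_sdiff hUf, character, Set.inter_sdiff_distrib_left,
      Set.inter_sdiff_distrib_left]
    · rwa [← Set.inter_sdiff_distrib_left]
    · rwa [← Set.inter_sdiff_distrib_left]
  rw [Pi.add_apply, key F G, key G H, key F H]
  · ring
  all_goals
    intro x hx
    simp only [hU, Set.mem_union, Set.mem_inter_iff, Set.mem_sdiff] at hx ⊢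
    tauto

/-- By `fibre_total` at most one of the two counts in each coordinate is nonzero, so no cancellation
can hide a difference. -/
theorem IsWeighted.eq_of_character_eq_zero (h : IsWeighted A ε) {F F' : ProperIdeal ε}
    (h0 : character ε F F' = 0) : F = F' := by
  have key : ∀ p, {α | ε α = p} ∩ (F.1 \ F'.1) = ∅ ∧ {α | ε α = p} ∩ (F'.1 \ F.1) = ∅ := by
    intro p
    have hp := congrFun h0 p
    simp only [character, Pi.zero_apply] at hp
    have h₁ := Set.ncard_eq_zero (h.finite_fibre_sdiff F F' p)
    have h₂ := Set.ncard_eq_zero (h.finite_fibre_sdiff F' F p)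
    rcases fibre_total h.chain F.2.isLowerSet F'.2.isLowerSet p with h' | h' <;>
      rw [h', Set.ncard_empty] at hp
    · exact ⟨h', h₂.1 (by omega)⟩
    · exact ⟨h₁.1 (by omega), h'⟩
  refine Subtype.ext (Set.Subset.antisymm (fun x hx => ?_) fun x hx => ?_) <;> by_contra hx'
  · exact Set.eq_empty_iff_forall_notMem.1 (key (ε x)).1 x ⟨rfl, hx, hx'⟩
  · exact Set.eq_empty_iff_forall_notMem.1 (key (ε x)).2 x ⟨rfl, hx, hx'⟩

theorem IsWeighted.character_injective (h : IsWeighted A ε) (F₀ : ProperIdeal ε) :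
    Function.Injective (character ε F₀) := fun F F' hFF' =>
  h.eq_of_character_eq_zero (by
    have := h.character_add F₀ F F'
    rwa [hFF', add_eq_left] at this)

variable [Fintype P]

theorem IsWeighted.finite_sdiff (h : IsWeighted A ε) (F F' : ProperIdeal ε) :
    (F.1 \ F'.1).Finite := by
  refine (Set.finite_iUnion fun p => h.finite_fibre_sdiff F F' p).subset fun x hx => ?_
  exact Set.mem_iUnion.2 ⟨ε x, rfl, hx⟩

theorem IsWeighted.weight_eq_of_subset [DecidableEq P] (h : IsWeighted A ε) (i : P)
    {F F' : ProperIdeal ε} (hFF' : F.1 ⊆ F'.1) :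
    weight ε i F'.1 = weight ε i F.1 + coroot A i (character ε F F') := by
  induction hn : (F'.1 \ F.1).ncard generalizing F with
  | zero =>
    have hsub : F'.1 ⊆ F.1 :=
      Set.sdiff_eq_empty.1 ((Set.ncard_eq_zero (h.finite_sdiff F' F)).1 hn)
    obtain rfl : F = F' := Subtype.ext (hFF'.antisymm hsub)
    simp [character_self]
  | succ n ih =>
    have hne : (F'.1 \ F.1).Nonempty := Set.nonempty_of_ncard_ne_zero (by omega)
    -- Minimality of `γ` is what keeps `F ∪ {γ}` an ideal.
    obtain ⟨γ, hγ⟩ := (h.finite_sdiff F' F).exists_minimal hne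
    have hlow : IsLowerSet (F.1 ∪ {γ}) := by
      rintro u v hvu (hu | rfl)
      · exact Or.inl (F.2.isLowerSet hvu hu)
      · by_cases hv : v ∈ F.1
        · exact Or.inl hv
        · exact Or.inr (le_antisymm hvu
            (hγ.2 ⟨F'.2.isLowerSet hvu hγ.1.1, hv⟩ hvu))
    have hsub : F.1 ∪ {γ} ⊆ F'.1 := Set.union_subset hFF' (by simpa using hγ.1.1)
    let G : ProperIdeal ε :=
      ⟨F.1 ∪ {γ}, isProperIdeal_of_subset F.2 F'.2 hlow Set.subset_union_left hsub⟩
    have hG : (F'.1 \ G.1).ncard = n := by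
      have : F'.1 \ G.1 = (F'.1 \ F.1) \ {γ} := by
        rw [Set.sdiff_sdiff]
      rw [this, Set.ncard_sdiff_singleton_of_mem hγ.1]
      omega
    rw [ih (F := G) hsub hG, h.weight_insert i F.1 γ F.2 hγ.1.2 hlow, ← h.character_add F G F',
      character_insert (F' := G) hγ.1.2 rfl, map_add, coroot_single, add_assoc]

theorem IsWeighted.weight_eq [DecidableEq P] (h : IsWeighted A ε) (i : P) (F F' : ProperIdeal ε) :
    weight ε i F'.1 = weight ε i F.1 + coroot A i (character ε F F') := by
  let G : ProperIdeal ε := ⟨F.1 ∩ F'.1, h.isProperIdeal_inter F F'⟩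
  have h₁ := h.weight_eq_of_subset i (F := G) (F' := F) Set.inter_subset_left
  have h₂ := h.weight_eq_of_subset i (F := G) (F' := F') Set.inter_subset_right
  rw [h₂, h₁, ← h.character_add F G F', map_add, character_swap G F, map_neg]
  ring

end Character

/-! ### The operators `S_i` on proper ideals -/

section SimpleMove

variable {P E : Type*} [PartialOrder E] {A : Matrix P P ℤ} {ε : E → P}

theorem IsWeighted.removable_eq (h : IsWeighted A ε) {i : P} {F : Set E} {γ : E}
    (hγ : γ ∈ removable ε i F) : removable ε i F = {γ} := by
  refine Set.Subset.antisymm (fun x hx => ?_) (by simpa using hγ)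
  by_contra hne
  rcases h.chain x γ (hx.1.trans hγ.1.symm) with h' | h'
  · exact (hx.2.2 h' ⟨hγ.2.1, fun h'' => hne (Eq.symm h'')⟩).2 rfl
  · exact (hγ.2.2 h' ⟨hx.2.1, hne⟩).2 rfl

theorem IsWeighted.addable_eq (h : IsWeighted A ε) {i : P} {F : Set E} {γ : E}
    (hγ : γ ∈ addable ε i F) : addable ε i F = {γ} := by
  refine Set.Subset.antisymm (fun x hx => ?_) (by simpa using hγ)
  by_contra hne
  rcases h.chain x γ (hx.1.trans hγ.1.symm) with h' | h'
  · exact (hγ.2.2 h' (Or.inr rfl)).elim hx.2.1 hne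
  · exact (hx.2.2 h' (Or.inr rfl)).elim hγ.2.1 fun h'' => hne (Eq.symm h'')

theorem IsWeighted.exists_simpleMove [DecidableEq P] (h : IsWeighted A ε) (i : P)
    (F : ProperIdeal ε) : ∃ F' : ProperIdeal ε, F'.1 = simpleMove ε i F.1 ∧
      character ε F F' = -weight ε i F.1 • Pi.single i 1 := by
  rw [simpleMove, weight]
  by_cases hr : (removable ε i F.1).Nonempty
  · have ha : ¬ (addable ε i F.1).Nonempty := fun ha => h.not_both i F.1 F.2 ha hr
    obtain ⟨γ, hγ⟩ := hr
    rw [if_pos ⟨γ, hγ⟩, if_pos ⟨γ, hγ⟩, if_neg ha, h.removable_eq hγ]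
    let G : ProperIdeal ε := ⟨F.1 \ {γ}, isProperIdeal_diff_singleton h.unbounded_below F.2 hγ.2.2⟩
    refine ⟨G, rfl, ?_⟩
    have hG : F.1 = G.1 ∪ {γ} := by
      rw [Set.sdiff_union_of_subset (by simpa using hγ.2.1)]
    rw [character_swap G F, character_insert (γ := γ) (show γ ∉ F.1 \ {γ} from fun h' => h'.2 rfl) hG, hγ.1]
    simp
  · rw [if_neg hr, if_neg hr]
    by_cases ha : (addable ε i F.1).Nonempty
    · obtain ⟨γ, hγ⟩ := ha
      rw [if_pos ⟨γ, hγ⟩, if_pos ⟨γ, hγ⟩, h.addable_eq hγ]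
      let G : ProperIdeal ε :=
        ⟨F.1 ∪ {γ}, isProperIdeal_union_singleton h.unbounded_above F.2 hγ.2.2⟩
      refine ⟨G, rfl, ?_⟩
      rw [character_insert hγ.2.1 (F' := G) rfl, hγ.1]
      simp
    · rw [if_neg ha, if_neg ha]
      exact ⟨F, rfl, by simp [character_self]⟩

/-- The operator `S_i` on the set of proper ideals. -/
noncomputable def moveIdeal [DecidableEq P] (h : IsWeighted A ε) (i : P) (F : ProperIdeal ε) :
    ProperIdeal ε := (h.exists_simpleMove i F).choose

theorem moveIdeal_val [DecidableEq P] (h : IsWeighted A ε) (i : P) (F : ProperIdeal ε) :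
    (moveIdeal h i F).1 = simpleMove ε i F.1 := (h.exists_simpleMove i F).choose_spec.1

theorem character_moveIdeal [DecidableEq P] (h : IsWeighted A ε) (i : P) (F : ProperIdeal ε) :
    character ε F (moveIdeal h i F) = -weight ε i F.1 • Pi.single i 1 :=
  (h.exists_simpleMove i F).choose_spec.2

theorem IsWeighted.exists_character_eq_single [DecidableEq P] (h : IsWeighted A ε) (i : P) :
    ∃ F F' : ProperIdeal ε, character ε F F' = Pi.single i 1 := by
  obtain ⟨α, rfl, hα⟩ := h.exists_proper i
  have hlow : IsLowerSet (Set.Iic α \ {α}) := by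
    rw [Set.Iic_sdiff_right]
    exact isLowerSet_Iio α
  refine ⟨⟨_, isProperIdeal_diff_singleton h.unbounded_below hα hlow⟩, ⟨_, hα⟩,
    character_insert (γ := α) (show α ∉ Set.Iic α \ {α} from fun h' => h'.2 rfl) ?_⟩
  rw [Set.sdiff_union_of_subset (by simp)]

end SimpleMove

/-! ### Affine reflections and the Coxeter relations -/

section AffineReflection

variable {P : Type*} [Fintype P] [DecidableEq P]

/-- The reflection of `ℤΠ` in the affine hyperplane `⟨v, α_i^∨⟩ = -b_i`. -/
def affineReflection (A : Matrix P P ℤ) (b : P → ℤ) (i : P) (v : P → ℤ) : P → ℤ :=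
  v - (coroot A i v + b i) • Pi.single i 1

theorem affineReflection_affineReflection {A : Matrix P P ℤ} (hA : IsGCM A) (b : P → ℤ) (i : P)
    (v : P → ℤ) : affineReflection A b i (affineReflection A b i v) = v := by
  simp only [affineReflection, map_sub, map_smul, coroot_single, hA.diag]
  module

theorem affineReflection_comp (A : Matrix P P ℤ) (hA : IsGCM A) (b : P → ℤ) (i j : P) (v : P → ℤ)
    (c d : ℤ) :
    affineReflection A b i (affineReflection A b j
        (v + c • Pi.single i 1 + d • Pi.single j 1)) =
      v + (-c - (coroot A i v + b i) - A i j * (-d - (coroot A j v + b j) - A j i * c)) •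
          Pi.single i 1 + (-d - (coroot A j v + b j) - A j i * c) • Pi.single j 1 := by
  simp only [affineReflection, map_add, map_sub, map_smul, coroot_single, hA.diag]
  module

/-- The affine reflections satisfy the Coxeter relations. -/
theorem affineReflection_iterate {A : Matrix P P ℤ} (hA : IsGCM A) (b : P → ℤ) (i j : P)
    (v : P → ℤ) :
    (fun u => affineReflection A b i (affineReflection A b j u))^[coxeterMatrix A i j] v = v := by
  by_cases hij : i = j
  · subst hij
    rw [CoxeterMatrix.diagonal, Function.iterate_one, affineReflection_affineReflection hA]
  · have hM : coxeterMatrix A i j =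
        if A i j * A j i = 0 then 2 else if A i j * A j i = 1 then 3
        else if A i j * A j i = 2 then 4 else if A i j * A j i = 3 then 6 else 0 := by
      simp [coxeterMatrix, hij]
    rw [hM]
    -- In the form `v + c α_i + d α_j` the composite acts on `(c, d)` alone, so each relation
    -- becomes an integer identity.
    have h0 : v = v + (0 : ℤ) • Pi.single i 1 + (0 : ℤ) • Pi.single j 1 := by simp
    have step := affineReflection_comp A hA b i j v
    have hz := hA.zero_symm i j
    have n1 := hA.nonpos i j hij
    have n2 := hA.nonpos j i (Ne.symm hij)
    -- The signs and the symmetry of zeros leave five pairs of entries; for `(-2, -2)` the exponent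
    -- is `0` and nothing is to be proved.
    rcases hA.doublyLaced i j with a | a | a | a <;>
      rcases hA.doublyLaced j i with b | b | b | b <;>
      first
      | (exfalso; omega)
      | (rw [a, b] at step
         rw [a, b]
         norm_num
         try (conv_lhs => rw [h0]
              simp only [step]
              module))

end AffineReflection

/-! ### The Weyl group action and equivariance of characters -/

section Action

variable {P E : Type*} [PartialOrder E] [LocallyFiniteOrder E] [Fintype P] [DecidableEq P]
  {A : Matrix P P ℤ} {ε : E → P}

theorem IsWeighted.character_moveIdeal_right (h : IsWeighted A ε) (F₀ F : ProperIdeal ε) (i : P) :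
    character ε F₀ (moveIdeal h i F) =
      affineReflection A (fun j => weight ε j F₀.1) i (character ε F₀ F) := by
  rw [← h.character_add F₀ F, character_moveIdeal, h.weight_eq i F₀ F, affineReflection]
  module

theorem IsWeighted.character_moveIdeal_moveIdeal (h : IsWeighted A ε) (hA : IsGCM A)
    (F F' : ProperIdeal ε) (i : P) :
    character ε (moveIdeal h i F) (moveIdeal h i F') =
      simpleReflection A hA i (character ε F F') := by
  rw [simpleReflection_apply, ← h.character_add _ F, ← h.character_add F F', character_swap F,
    character_moveIdeal, character_moveIdeal, h.weight_eq i F F']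
  module

theorem moveIdeal_involutive (h : IsWeighted A ε) (hA : IsGCM A) (i : P) :
    Function.Involutive (moveIdeal h i) := fun F => h.character_injective F (by
  rw [h.character_moveIdeal_right, h.character_moveIdeal_right,
    affineReflection_affineReflection hA])

/-- The operator `S_i` as a permutation of the set of proper ideals. -/
noncomputable def movePerm (h : IsWeighted A ε) (hA : IsGCM A) (i : P) :
    Equiv.Perm (ProperIdeal ε) := (moveIdeal_involutive h hA i).toPerm

theorem movePerm_apply (h : IsWeighted A ε) (hA : IsGCM A) (i : P) (F : ProperIdeal ε) :
    movePerm h hA i F = moveIdeal h i F := rfl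

theorem movePerm_isLiftable (h : IsWeighted A ε) (hA : IsGCM A) :
    (coxeterMatrix A).IsLiftable (movePerm h hA) := by
  intro i j
  -- The ideal `F` itself is the base point, so its weights are the constants of the affine
  -- reflections.
  refine Equiv.ext fun F => h.character_injective F ?_
  have key : ∀ n, character ε F (((movePerm h hA i * movePerm h hA j) ^ n) F) =
      (fun u => affineReflection A (fun j => weight ε j F.1) i
        (affineReflection A (fun j => weight ε j F.1) j u))^[n] (character ε F F) := by
    intro n
    induction n with
    | zero => rfl
    | succ n ih =>
      rw [pow_succ', Equiv.Perm.mul_apply, Equiv.Perm.mul_apply, movePerm_apply, movePerm_apply,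
        h.character_moveIdeal_right, h.character_moveIdeal_right, ih,
        Function.iterate_succ_apply']
  rw [key, affineReflection_iterate hA, Equiv.Perm.one_apply]

/-- The action of the Weyl group on the set of proper ideals. -/
noncomputable def idealAction (h : IsWeighted A ε) (hA : IsGCM A) :
    WeylGroup A →* Equiv.Perm (ProperIdeal ε) :=
  (coxeterMatrix A).toCoxeterSystem.lift ⟨movePerm h hA, movePerm_isLiftable h hA⟩

theorem idealAction_simple (h : IsWeighted A ε) (hA : IsGCM A) (i : P) :
    idealAction h hA ((coxeterMatrix A).simple i) = movePerm h hA i :=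
  (coxeterMatrix A).toCoxeterSystem.lift_apply_simple (movePerm_isLiftable h hA) i

theorem character_idealAction (h : IsWeighted A ε) (hA : IsGCM A) (F F' : ProperIdeal ε)
    (w : WeylGroup A) :
    character ε (idealAction h hA w F) (idealAction h hA w F') =
      rootRep A hA w (character ε F F') := by
  induction w using (coxeterMatrix A).toCoxeterSystem.simple_induction_left generalizing F F' with
  | one => simp
  | mul_simple_left w i ih =>
    have hs : (coxeterMatrix A).toCoxeterSystem.simple i = (coxeterMatrix A).simple i := rfl
    rw [hs, map_mul, map_mul, Equiv.Perm.mul_apply, Equiv.Perm.mul_apply, idealAction_simple,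
      rootRep_simple, movePerm_apply, movePerm_apply, h.character_moveIdeal_moveIdeal hA, ih,
      LinearEquiv.mul_apply]

theorem rootRep_eq_one_of_idealAction_eq_one (h : IsWeighted A ε) (hA : IsGCM A)
    {w : WeylGroup A} (hw : idealAction h hA w = 1) : rootRep A hA w = 1 := by
  have key : ∀ i, rootRep A hA w (Pi.single i 1) = Pi.single i 1 := by
    intro i
    obtain ⟨F, F', hFF'⟩ := h.exists_character_eq_single i
    have := character_idealAction h hA F F' w
    rwa [hw, Equiv.Perm.one_apply, Equiv.Perm.one_apply, hFF', eq_comm] at this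
  refine LinearEquiv.toLinearMap_injective (LinearMap.pi_ext' fun i => LinearMap.ext_ring ?_)
  exact key i

end Action

/-! ### Faithfulness of the reflection representation -/

section Faithful

variable {P : Type*} [Fintype P] [DecidableEq P] {A : Matrix P P ℤ}

open CoxeterSystem

theorem rootRep_wordProd_cons (hA : IsGCM A) (i : P) (ω : List P) (v : P → ℤ) :
    rootRep A hA ((coxeterMatrix A).toCoxeterSystem.wordProd (i :: ω)) v =
      simpleReflection A hA i (rootRep A hA ((coxeterMatrix A).toCoxeterSystem.wordProd ω) v) := by
  have hs : (coxeterMatrix A).toCoxeterSystem.simple i = (coxeterMatrix A).simple i := rfl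
  rw [wordProd_cons, hs, map_mul, rootRep_simple, LinearEquiv.mul_apply]

theorem rootRep_alternatingWord_succ (hA : IsGCM A) {s t : P} {k : ℕ} {c d : ℤ} {v : P → ℤ}
    (hk : rootRep A hA ((coxeterMatrix A).toCoxeterSystem.wordProd (alternatingWord s t k)) v =
      c • Pi.single s 1 + d • Pi.single t 1) :
    rootRep A hA ((coxeterMatrix A).toCoxeterSystem.wordProd (alternatingWord s t (k + 1))) v =
      (if Even k then c else -c - A s t * d) • Pi.single s 1 +
        (if Even k then -d - A t s * c else d) • Pi.single t 1 := by
  rw [alternatingWord_succ', rootRep_wordProd_cons, hk, simpleReflection_apply]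
  split_ifs <;> simp only [map_add, map_smul, coroot_single, hA.diag] <;> module

/-- Rank two case of the positivity of roots. -/
theorem exists_nonneg_rootRep_alternatingWord (hA : IsGCM A) {s t : P} (hst : s ≠ t) {k : ℕ}
    (hk : coxeterMatrix A s t ≠ 0 → k < coxeterMatrix A s t) :
    ∃ c d : ℤ, 0 ≤ c ∧ 0 ≤ d ∧
      rootRep A hA ((coxeterMatrix A).toCoxeterSystem.wordProd (alternatingWord s t k))
        (Pi.single s 1) = c • Pi.single s 1 + d • Pi.single t 1 := by
  have hM : coxeterMatrix A s t =
      if A s t * A t s = 0 then 2 else if A s t * A t s = 1 then 3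
      else if A s t * A t s = 2 then 4 else if A s t * A t s = 3 then 6 else 0 := by
    simp [coxeterMatrix, hst]
  rw [hM] at hk
  have r₀ : rootRep A hA ((coxeterMatrix A).toCoxeterSystem.wordProd (alternatingWord s t 0))
      (Pi.single s 1) = (1 : ℤ) • Pi.single s 1 + (0 : ℤ) • Pi.single t 1 := by
    simp [alternatingWord]
  have r₁ := rootRep_alternatingWord_succ hA r₀
  have r₂ := rootRep_alternatingWord_succ hA r₁
  have r₃ := rootRep_alternatingWord_succ hA r₂
  have hz := hA.zero_symm s t
  have n₁ := hA.nonpos s t hst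
  have n₂ := hA.nonpos t s hst.symm
  -- In the infinite dihedral case the coefficients are `k` and `k + 1` in some order; otherwise the
  -- Coxeter exponent is at most `4`, so `k ≤ 3`.
  by_cases h4 : A s t = -2 ∧ A t s = -2
  · have key : ∀ n : ℕ, rootRep A hA
        ((coxeterMatrix A).toCoxeterSystem.wordProd (alternatingWord s t n)) (Pi.single s 1) =
          (if Even n then (n + 1 : ℤ) else n) • Pi.single s 1 +
            (if Even n then (n : ℤ) else n + 1) • Pi.single t 1 := by
      intro n
      induction n with
      | zero => simpa using r₀
      | succ n ih =>
        rw [rootRep_alternatingWord_succ hA ih, h4.1, h4.2]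
        by_cases hn : Even n <;> simp only [hn, Nat.even_add_one, if_true, if_false, not_true,
          not_false_iff] <;> push_cast <;> congr 2 <;> ring
    refine ⟨_, _, ?_, ?_, key k⟩ <;> split_ifs <;> positivity
  · rcases hA.doublyLaced s t with a | a | a | a <;>
      rcases hA.doublyLaced t s with b | b | b | b <;>
      first
      | (exfalso; omega)
      | (rw [a, b] at r₁ r₂ r₃
         rw [a, b] at hk
         norm_num at hk
         interval_cases k <;>
          first
          | exact ⟨_, _, by norm_num, by norm_num, r₀⟩
          | exact ⟨_, _, by norm_num, by norm_num, r₁⟩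
          | exact ⟨_, _, by norm_num [Nat.even_add_one], by norm_num [Nat.even_add_one], r₂⟩
          | exact ⟨_, _, by norm_num [Nat.even_add_one], by norm_num [Nat.even_add_one], r₃⟩)

section Length

variable {B W : Type*} [Group W] {M : CoxeterMatrix B} (cs : CoxeterSystem M W)

theorem exists_eq_mul_alternatingWord_of_le {s t : B} {w : W} {k : ℕ}
    (h : ∃ v, w = v * cs.wordProd (alternatingWord s t k) ∧ cs.length v + k = cs.length w)
    {j : ℕ} (hj : j ≤ k) :
    ∃ v, w = v * cs.wordProd (alternatingWord s t j) ∧ cs.length v + j = cs.length w := by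
  induction k, hj using Nat.le_induction with
  | base => exact h
  | succ k _ ih =>
    obtain ⟨v, hv, hlen⟩ := h
    rw [alternatingWord_succ', wordProd_cons, ← mul_assoc] at hv
    refine ih ⟨_, hv, ?_⟩
    generalize (if Even k then t else s) = x at hv
    have h₁ := cs.length_mul_le (v * cs.simple x) (cs.wordProd (alternatingWord s t k))
    have h₂ := cs.length_wordProd_le (alternatingWord s t k)
    rw [length_alternatingWord] at h₂
    rw [← hv] at h₁
    rcases cs.length_mul_simple v x with h₃ | h₃ <;> omega

/-- An element `w` with `ℓ(ws) > ℓ(w) > ℓ(wt)` factors as `v u` with `u` in the dihedral subgroup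
of `s` and `t`, `ℓ(w) = ℓ(v) + ℓ(u)` and `v` of minimal length in its coset. -/
theorem exists_eq_mul_alternatingWord {s t : B} {w : W}
    (hs : cs.length w < cs.length (w * cs.simple s))
    (ht : cs.length (w * cs.simple t) < cs.length w) :
    ∃ (k : ℕ) (v : W), w = v * cs.wordProd (alternatingWord s t k) ∧ cs.length v < cs.length w ∧
      cs.length v < cs.length (v * cs.simple s) ∧ cs.length v < cs.length (v * cs.simple t) ∧
      (M s t ≠ 0 → k < M s t) := by
  classical
  let C : ℕ → Prop := fun k =>
    ∃ v, w = v * cs.wordProd (alternatingWord s t k) ∧ cs.length v + k = cs.length w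
  have h1 : C 1 := by
    refine ⟨w * cs.simple t, by simp [alternatingWord], ?_⟩
    rcases cs.length_mul_simple w t with h | h <;> omega
  have hle : ∀ k, C k → k ≤ cs.length w := by
    rintro k ⟨v, -, h⟩
    omega
  -- The longest alternating suffix ending in `t` that splits off with additive lengths; the descent
  -- `t` provides `k ≥ 1`.
  set k := Nat.findGreatest C (cs.length w) with hk
  have hCk : C k := Nat.findGreatest_spec (hle 1 h1) h1
  have hk1 : 1 ≤ k := Nat.le_findGreatest (hle 1 h1) h1
  have hmax : ¬ C (k + 1) := fun h => by
    have := Nat.le_findGreatest (hle _ h) h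
    omega
  obtain ⟨v, hv, hlen⟩ := hCk
  obtain ⟨l, hl⟩ : ∃ l, k = l + 1 := ⟨k - 1, by omega⟩
  -- If the next letter of the alternation shortened `v`, it could be moved into the suffix, against
  -- maximality.
  have hx : cs.length v < cs.length (v * cs.simple (if Even k then t else s)) := by
    rcases cs.length_mul_simple v (if Even k then t else s) with h | h
    · omega
    · refine absurd ⟨v * cs.simple (if Even k then t else s), ?_, ?_⟩ hmax
      · rw [alternatingWord_succ', wordProd_cons, ← mul_assoc, mul_assoc v, simple_mul_simple_self,
          mul_one, ← hv]
      · omega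
  -- If the first letter of the suffix shortened `v`, then `w` would be shorter than `ℓ(v) + k`.
  have hy : cs.length v < cs.length (v * cs.simple (if Even l then t else s)) := by
    have hv' := hv
    rw [hl, alternatingWord_succ', wordProd_cons, ← mul_assoc] at hv'
    have h₁ := cs.length_mul_le (v * cs.simple (if Even l then t else s))
      (cs.wordProd (alternatingWord s t l))
    have h₂ := cs.length_wordProd_le (alternatingWord s t l)
    rw [length_alternatingWord] at h₂
    rw [← hv'] at h₁
    omega
  have hke : Even k ↔ ¬ Even l := by rw [hl, Nat.even_add_one]
  refine ⟨k, v, hv, by omega, ?_, ?_, fun hm => ?_⟩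
  · by_cases h : Even l
    · simpa [hke, h] using hx
    · simpa [h] using hy
  · by_cases h : Even l
    · simpa [h] using hy
    · simpa [hke, h] using hx
  -- A reduced suffix of length `M s t` could be rewritten by the braid relation to end in `s`,
  -- making `s` a descent of `w`.
  · by_contra! hmk
    obtain ⟨u, hu, hulen⟩ := exists_eq_mul_alternatingWord_of_le cs ⟨v, hv, hlen⟩ hmk
    obtain ⟨m, hm'⟩ : ∃ m, M s t = m + 1 := ⟨M s t - 1, by omega⟩
    have hb := cs.wordProd_braidWord_eq s t
    rw [braidWord, braidWord, M.symmetric t s] at hb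
    rw [hb, hm', alternatingWord_succ, wordProd_concat, ← mul_assoc] at hu
    have hws : w * cs.simple s = u * cs.wordProd (alternatingWord s t m) := by
      rw [hu, mul_assoc, simple_mul_simple_self, mul_one]
    have h₁ := cs.length_mul_le u (cs.wordProd (alternatingWord s t m))
    have h₂ := cs.length_wordProd_le (alternatingWord s t m)
    rw [length_alternatingWord] at h₂
    rw [← hws] at h₁
    omega

end Length

/-- If `ℓ(w s_i) > ℓ(w)`, then `w(α_i)` is positive. -/
theorem rootRep_single_nonneg (hA : IsGCM A) (w : WeylGroup A) (s : P)
    (hs : (coxeterMatrix A).toCoxeterSystem.length w <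
      (coxeterMatrix A).toCoxeterSystem.length
        (w * (coxeterMatrix A).toCoxeterSystem.simple s)) :
    0 ≤ rootRep A hA w (Pi.single s 1) := by
  induction hn : (coxeterMatrix A).toCoxeterSystem.length w using Nat.strong_induction_on
    generalizing w s with
  | _ n ih =>
  subst hn
  by_cases hw : w = 1
  · subst hw
    rw [map_one, LinearEquiv.coe_one, id]
    exact Pi.single_nonneg.2 zero_le_one
  · obtain ⟨t, ht⟩ := (coxeterMatrix A).toCoxeterSystem.exists_rightDescent_of_ne_one hw
    have hst : s ≠ t := by
      rintro rfl
      exact lt_asymm hs ht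
    obtain ⟨k, v, hv, hlen, h₁, h₂, hk⟩ :=
      exists_eq_mul_alternatingWord (coxeterMatrix A).toCoxeterSystem hs ht
    obtain ⟨c, d, hc, hd, hcd⟩ := exists_nonneg_rootRep_alternatingWord hA hst hk
    rw [hv, map_mul, LinearEquiv.mul_apply, hcd, map_add, map_smul, map_smul]
    exact add_nonneg (smul_nonneg hc (ih _ hlen v s h₁ rfl))
      (smul_nonneg hd (ih _ hlen v t h₂ rfl))

/-- The reflection representation of the Weyl group on the root lattice is faithful. -/
theorem rootRep_eq_one_iff (hA : IsGCM A) {w : WeylGroup A} : rootRep A hA w = 1 ↔ w = 1 := by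
  refine ⟨fun hw => ?_, fun hw => hw ▸ map_one _⟩
  by_contra hne
  obtain ⟨t, ht⟩ := (coxeterMatrix A).toCoxeterSystem.exists_rightDescent_of_ne_one hne
  have hs : (coxeterMatrix A).toCoxeterSystem.simple t = (coxeterMatrix A).simple t := rfl
  -- If `w` acts trivially, then `wt` sends `α_t` to `-α_t`, whereas `ℓ(wt) < ℓ(w)` makes this image
  -- nonnegative.
  have hpos := rootRep_single_nonneg hA (w * (coxeterMatrix A).toCoxeterSystem.simple t) t (by
    rwa [mul_assoc, simple_mul_simple_self, mul_one])
  rw [map_mul, hw, one_mul, hs, rootRep_simple, simpleReflection_apply, coroot_single,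
    hA.diag] at hpos
  have := hpos t
  simp at this

theorem rootRep_mem_realRoots (hA : IsGCM A) (w : WeylGroup A) {v : P → ℤ}
    (hv : v ∈ realRoots A hA) : rootRep A hA w v ∈ realRoots A hA := by
  obtain ⟨u, i, rfl⟩ := hv
  exact ⟨w * u, i, by rw [map_mul, LinearEquiv.mul_apply]⟩

theorem rootRep_mem_realRoots_iff (hA : IsGCM A) (w : WeylGroup A) (v : P → ℤ) :
    rootRep A hA w v ∈ realRoots A hA ↔ v ∈ realRoots A hA := by
  refine ⟨fun h => ?_, rootRep_mem_realRoots hA w⟩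
  have := rootRep_mem_realRoots hA w⁻¹ h
  rwa [← LinearEquiv.mul_apply, ← map_mul, inv_mul_cancel, map_one, LinearEquiv.coe_one,
    id] at this

end Faithful

end FullHeap

theorem theorem4p1 {P : Type*} [Fintype P] [DecidableEq P] {E : Type*} [PartialOrder E]
    [LocallyFiniteOrder E] (A : Matrix P P ℤ) (hA : FullHeap.IsAffine A) (ε : E → P)
    (hE : FullHeap.IsSimplyFoldedFull A ε) :
    (∀ F F' : FullHeap.ProperIdeal ε, (F.1 \ F'.1).Finite) ∧
    ∃ ρ : FullHeap.WeylGroup A →* Equiv.Perm (FullHeap.ProperIdeal ε),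
      (∀ (i : P) (F : FullHeap.ProperIdeal ε),
        (ρ ((FullHeap.coxeterMatrix A).simple i) F).1 = FullHeap.simpleMove ε i F.1) ∧
      (∀ (F F' : FullHeap.ProperIdeal ε) (w : FullHeap.WeylGroup A),
        FullHeap.character ε (ρ w F) (ρ w F') =
          FullHeap.rootRep A hA.gcm w (FullHeap.character ε F F')) ∧
      (∀ (F F' : FullHeap.ProperIdeal ε) (w : FullHeap.WeylGroup A),
        FullHeap.IsSkew A hA.gcm ε F F' ↔ FullHeap.IsSkew A hA.gcm ε (ρ w F) (ρ w F')) ∧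
      Function.Injective ρ := by
  have h := hE.isWeighted hA
  refine ⟨h.finite_sdiff, FullHeap.idealAction h hA.gcm, fun i F => ?_,
    FullHeap.character_idealAction h hA.gcm, fun F F' w => ?_, ?_⟩
  · rw [FullHeap.idealAction_simple, FullHeap.movePerm_apply, FullHeap.moveIdeal_val]
  · rw [FullHeap.IsSkew, FullHeap.IsSkew, FullHeap.character_idealAction h hA.gcm]
    exact (FullHeap.rootRep_mem_realRoots_iff hA.gcm w _).symm
  · exact (injective_iff_map_eq_one _).2 fun w hw => (FullHeap.rootRep_eq_one_iff hA.gcm).1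
      (FullHeap.rootRep_eq_one_of_idealAction_eq_one h hA.gcm hw)
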